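/- Let $T$ be a bounded linear operator on the complex space $\ell^2(\mathbb{Z})$. Suppose there is a function $K:\{(n,m)\in\mathbb{Z}\times\mathbb{Z}:\ |n|\neq|m|\}\to\mathbb{C}$ such that for every $f\in\ell^2(\mathbb{Z})$ $$T(f)(n)=\sum_{m\in\mathbb{Z},\ |m|\neq|n|}K(n,m)f(m)\qquad\text{for all } n\in\mathbb{Z} \text{ with } f(n)=f(-n)=0.$$ Assume that there is a constant $C$ such that (i) $|K(n,m)|\le \dfrac{C}{|n-m|}$ for all $n,m\in\mathbb{Z}$ with $|n|\ne|m|$; (ii) $|K(n,m)-K(n,\ell)|+|K(m,n)-K(\ell,n)|\le C\,\dfrac{|m-\ell|}{(|m|-|n|)^2}$ for all $n,m,\ell\in\mathbb{Z}$ such that $\big||m|-|n|\big|>2|m-\ell|$ and $\dfrac{|n|}{2}\le|m|,|\ell|\le\dfrac{3|n|}{2}$. Then for every $1<p<\infty$ the operator $T$ extends to a bounded linear operator on $\ell^p(\mathbb{Z})$: there is a bounded linear operator $S:\ell^p(\mathbb{Z})\to\ell^p(\mathbb{Z})$ with $Sf=Tf$ for all $f\in\ell^2(\mathbb{Z})\cap\ell^p(\mathbb{Z})$.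 -/

import Mathlib

open scoped ENNReal

/-- The complex sequence space `ℓ^p(ℤ)` with its usual norm. -/
abbrev EllZ (p : ℝ≥0∞) : Type := lp (fun _ : ℤ => ℂ) p

/-- `T` has kernel `K` off the set `|n| = |m|`: for every `f ∈ ℓ²(ℤ)` and every `n` with
`f n = f (-n) = 0`, one has `T f n = ∑ m, K n m * f m`. The values `K n m` with `|n| = |m|`
play no role, since they are multiplied by `f n = 0` or `f (-n) = 0`. -/
def HasOffDiagKernel (T : EllZ 2 →L[ℂ] EllZ 2) (K : ℤ → ℤ → ℂ) : Prop :=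
  ∀ (f : EllZ 2) (n : ℤ), f n = 0 → f (-n) = 0 → T f n = ∑' m : ℤ, K n m * f m

/-- A bounded operator `T` on `ℓ²(ℤ)` extends to a bounded operator on `ℓ^p(ℤ)`: some bounded
linear `S` on `ℓ^p(ℤ)` coincides with `T` on `ℓ²(ℤ) ∩ ℓ^p(ℤ)`. -/
def ExtendsBoundedly (T : EllZ 2 →L[ℂ] EllZ 2) (p : ℝ≥0∞) [Fact (1 ≤ p)] : Prop :=
  ∃ S : EllZ p →L[ℂ] EllZ p, ∀ (f : ℤ → ℂ) (h2 : Memℓp f 2) (hp : Memℓp f p) (n : ℤ),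
    S (⟨f, hp⟩ : EllZ p) n = T (⟨f, h2⟩ : EllZ 2) n

/-!
The operator `T` is given by the matrix `A n m = (T eₘ) n`, which equals `K n m` when `|n| ≠ |m|`
and is bounded by `‖T‖` on the two diagonals `m = ±n`. The proof is Calderón–Zygmund theory for
finite sections of `A`, with bounds independent of the section.

*Weak type (1,1)* (`IsCZMatrix.weak_type`). Fix a row `n ≠ 0` and split the columns into three parts.

* Columns `m` of the same sign as `n` and of comparable dyadic size. For rows in one dyadic block
  `[2^j, 2^(j+1))` the kernel satisfies Hörmander's condition (`hormander_dyadic_block`): where both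
  columns are comparable to `n` the regularity assumption gives a convergent sum, and elsewhere the
  size assumption gives `O(2^(-j))` for each of the `2^j` rows. With the `ℓ²` bound, the
  Calderón–Zygmund decomposition yields the weak estimate on each block (`weak_type_of_hormander`);
  each column meets at most three blocks, so the estimates add up (`weak_type_near_diagonal`).
  Working block by block makes it unnecessary to cut off the kernel, so no `ℓ²` bound for a
  truncated operator is needed.
* The column `m = -n`, where the entry is bounded.
* All other columns, where `|n - m| ≥ |n| / 2`. Their contribution is `O(‖f‖₁ / |n|)`, a function
  of `n` that is of weak type (1,1) for a trivial reason.

*All exponents.* The weak bound and the `ℓ²` bound give `ℓ^p` bounds for `1 < p < 2` by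
Marcinkiewicz interpolation (`sum_rpow_le_of_weak_strong`). The assumptions are symmetric under
transposition of the kernel, so the transposed matrix has the same bounds, and duality
(`sum_rpow_le_of_transpose`) covers `2 < p < ∞`. Uniform bounds on finite sections make
`f ↦ ∑' m, A n m * f m` a bounded operator on `ℓ^p` which agrees with `T` on `ℓ² ∩ ℓ^p`
(`extendsBoundedly_of_sum_rpow_le`).
-/

/-! ### The Calderón–Zygmund decomposition -/

/-- Chebyshev's inequality for a finite sum. -/
theorem card_mul_le_of_sum_le {ι : Type*} (E : Finset ι) (u : ι → ℝ) (hu : ∀ i ∈ E, 0 ≤ u i)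
    {t X : ℝ} (hX : ∑ i ∈ E, u i ≤ X) :
    t * ((E.filter fun i => t < u i).card : ℝ) ≤ X := by
  calc t * ((E.filter fun i => t < u i).card : ℝ) = ∑ i ∈ E.filter (fun i => t < u i), t := by
        rw [Finset.sum_const, nsmul_eq_mul, mul_comm]
    _ ≤ ∑ i ∈ E.filter (fun i => t < u i), u i :=
        Finset.sum_le_sum fun i hi => (Finset.mem_filter.1 hi).2.le
    _ ≤ ∑ i ∈ E, u i :=
        Finset.sum_le_sum_of_subset_of_nonneg (Finset.filter_subset _ _) fun i hi _ => hu i hi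
    _ ≤ X := hX

/-- A Calderón–Zygmund decomposition `f = g + (f - g)` on `Q` at height `t`, adapted to the matrix
`A` with rows in `E`: the good part `g` is at most `2 * t`, and the image of the bad part `f - g` has
`ℓ¹` norm `O(H * ‖f‖₁)` off an exceptional set `Ω` of size `O(‖f‖₁ / t)`. The image of the bad part is
recorded instead of its cancellation, because in this form the notion is additive over disjoint
sets `Q`. -/
def HasCZDecomp (A : ℕ → ℕ → ℂ) (E : Finset ℕ) (H t : ℝ) (f : ℕ → ℂ) (Q : Finset ℕ) : Prop :=
  ∃ (g : ℕ → ℂ) (Ω : Finset ℕ),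
    (∀ m ∈ Q, ‖g m‖ ≤ 2 * t) ∧
    ∑ m ∈ Q, ‖g m‖ ≤ ∑ m ∈ Q, ‖f m‖ ∧
    t * (Ω.card : ℝ) ≤ 7 * ∑ m ∈ Q, ‖f m‖ ∧
    ∑ n ∈ E \ Ω, ‖∑ m ∈ Q, A n m * (f m - g m)‖ ≤ 2 * H * ∑ m ∈ Q, ‖f m‖

theorem HasCZDecomp.union {A : ℕ → ℕ → ℂ} {E : Finset ℕ} {H t : ℝ} {f : ℕ → ℂ}
    {Q R : Finset ℕ} (ht : 0 ≤ t) (hd : Disjoint Q R) (hQ : HasCZDecomp A E H t f Q)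
    (hR : HasCZDecomp A E H t f R) : HasCZDecomp A E H t f (Q ∪ R) := by
  classical
  obtain ⟨g, Ω, h1, h2, h3, h4⟩ := hQ
  obtain ⟨g', Ω', h1', h2', h3', h4'⟩ := hR
  have hl : ∀ m ∈ Q, (if m ∈ Q then g m else g' m) = g m := fun m hm => if_pos hm
  have hr : ∀ m ∈ R, (if m ∈ Q then g m else g' m) = g' m :=
    fun m hm => if_neg (Finset.disjoint_right.1 hd hm)
  refine ⟨fun m => if m ∈ Q then g m else g' m, Ω ∪ Ω', ?_, ?_, ?_, ?_⟩
  · intro m hm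
    rcases Finset.mem_union.1 hm with hm | hm
    · simpa only [hl m hm] using h1 m hm
    · simpa only [hr m hm] using h1' m hm
  · rw [Finset.sum_union hd, Finset.sum_union hd]
    refine add_le_add (le_trans (Finset.sum_le_sum fun m hm => ?_) h2)
      (le_trans (Finset.sum_le_sum fun m hm => ?_) h2')
    · simp only [hl m hm, le_refl]
    · simp only [hr m hm, le_refl]
  · rw [Finset.sum_union hd]
    have : ((Ω ∪ Ω').card : ℝ) ≤ Ω.card + Ω'.card := by exact_mod_cast Finset.card_union_le _ _
    nlinarith
  · have e : ∀ n, ∑ m ∈ Q ∪ R, A n m * (f m - if m ∈ Q then g m else g' m) =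
        ∑ m ∈ Q, A n m * (f m - g m) + ∑ m ∈ R, A n m * (f m - g' m) := fun n => by
      rw [Finset.sum_union hd]
      congr 1
      · exact Finset.sum_congr rfl fun m hm => by rw [hl m hm]
      · exact Finset.sum_congr rfl fun m hm => by rw [hr m hm]
    have s1 : ∑ n ∈ E \ (Ω ∪ Ω'), ‖∑ m ∈ Q, A n m * (f m - g m)‖ ≤
        ∑ n ∈ E \ Ω, ‖∑ m ∈ Q, A n m * (f m - g m)‖ :=
      Finset.sum_le_sum_of_subset_of_nonneg
        (Finset.sdiff_subset_sdiff le_rfl Finset.subset_union_left) fun _ _ _ => norm_nonneg _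
    have s2 : ∑ n ∈ E \ (Ω ∪ Ω'), ‖∑ m ∈ R, A n m * (f m - g' m)‖ ≤
        ∑ n ∈ E \ Ω', ‖∑ m ∈ R, A n m * (f m - g' m)‖ :=
      Finset.sum_le_sum_of_subset_of_nonneg
        (Finset.sdiff_subset_sdiff le_rfl Finset.subset_union_right) fun _ _ _ => norm_nonneg _
    calc _ ≤ ∑ n ∈ E \ (Ω ∪ Ω'), (‖∑ m ∈ Q, A n m * (f m - g m)‖ +
          ‖∑ m ∈ R, A n m * (f m - g' m)‖) :=
          Finset.sum_le_sum fun n _ => by rw [e n]; exact norm_add_le _ _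
      _ ≤ _ := by rw [Finset.sum_add_distrib, Finset.sum_union hd]; linarith

/-- On a stopping interval, whose average lies between `t` and `2 * t`, the good part is the mean of
`f` and the exceptional set is the enlarged interval. Off the latter the mean-zero bad part is
controlled by Hörmander's condition, with the left endpoint `a` as reference point. -/
theorem hasCZDecomp_of_large_average {A : ℕ → ℕ → ℂ} {E : Finset ℕ} {H t : ℝ} {M : ℕ}
    (hH : ∀ m l : ℕ, m < M → l < M →
      ∑ n ∈ E.filter (fun n : ℕ => 2 * |(m : ℤ) - l| < |(n : ℤ) - m|), ‖A n m - A n l‖ ≤ H)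
    (f : ℕ → ℂ) {a L : ℕ} (hL : 0 < L) (haM : a + L ≤ M)
    (hlo : t * L ≤ ∑ m ∈ Finset.Ico a (a + L), ‖f m‖)
    (hhi : ∑ m ∈ Finset.Ico a (a + L), ‖f m‖ ≤ 2 * t * L) :
    HasCZDecomp A E H t f (Finset.Ico a (a + L)) := by
  set Q := Finset.Ico a (a + L) with hQ
  have hcard : Q.card = L := by simp [hQ]
  have hLr : (0 : ℝ) < L := by exact_mod_cast hL
  have hLc : (L : ℂ) ≠ 0 := by exact_mod_cast hL.ne'
  set c : ℂ := (∑ m ∈ Q, f m) / L with hc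
  have hcn : ‖c‖ * L ≤ ∑ m ∈ Q, ‖f m‖ := by
    rw [hc, norm_div, Complex.norm_natCast, div_mul_cancel₀ _ hLr.ne']
    exact norm_sum_le _ _
  have hsum : ∑ m ∈ Q, (f m - c) = 0 := by
    rw [Finset.sum_sub_distrib, Finset.sum_const, hcard, nsmul_eq_mul, hc,
      mul_div_cancel₀ _ hLc, sub_self]
  have hb : ∑ m ∈ Q, ‖f m - c‖ ≤ 2 * ∑ m ∈ Q, ‖f m‖ := by
    calc ∑ m ∈ Q, ‖f m - c‖ ≤ ∑ m ∈ Q, (‖f m‖ + ‖c‖) :=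
          Finset.sum_le_sum fun m _ => norm_sub_le _ _
      _ = ∑ m ∈ Q, ‖f m‖ + ‖c‖ * L := by
          rw [Finset.sum_add_distrib, Finset.sum_const, hcard, nsmul_eq_mul, mul_comm (L : ℝ)]
      _ ≤ _ := by linarith
  refine ⟨fun _ => c, Finset.Icc (a - 3 * L) (a + 3 * L), ?_, ?_, ?_, ?_⟩
  · intro m _
    exact le_of_mul_le_mul_right (hcn.trans hhi) hLr
  · rw [Finset.sum_const, hcard, nsmul_eq_mul, mul_comm]; exact hcn
  · have : (((Finset.Icc (a - 3 * L) (a + 3 * L)).card : ℕ) : ℝ) ≤ 7 * L := by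
      rw [Nat.card_Icc]; norm_cast; omega
    have ht : 0 ≤ t := by
      by_contra! h
      nlinarith [Finset.sum_nonneg fun m (_ : m ∈ Q) => norm_nonneg (f m)]
    nlinarith
  · have key : ∀ n, ∑ m ∈ Q, A n m * (f m - c) = ∑ m ∈ Q, (A n m - A n a) * (f m - c) := by
      intro n
      simp only [sub_mul, Finset.sum_sub_distrib (G := ℂ) (f := fun m => A n m * (f m - c))]
      rw [← Finset.mul_sum, hsum, mul_zero, sub_zero]
    calc ∑ n ∈ E \ Finset.Icc (a - 3 * L) (a + 3 * L), ‖∑ m ∈ Q, A n m * (f m - c)‖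
        ≤ ∑ n ∈ E \ Finset.Icc (a - 3 * L) (a + 3 * L),
            ∑ m ∈ Q, ‖A n m - A n a‖ * ‖f m - c‖ := by
          refine Finset.sum_le_sum fun n _ => ?_
          rw [key n]
          exact (norm_sum_le _ _).trans (Finset.sum_le_sum fun m _ => norm_mul_le _ _)
      _ = ∑ m ∈ Q, (∑ n ∈ E \ Finset.Icc (a - 3 * L) (a + 3 * L), ‖A n m - A n a‖) *
            ‖f m - c‖ := by
          rw [Finset.sum_comm]
          exact Finset.sum_congr rfl fun m _ => by rw [Finset.sum_mul]
      _ ≤ ∑ m ∈ Q, H * ‖f m - c‖ := by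
          refine Finset.sum_le_sum fun m hm => mul_le_mul_of_nonneg_right ?_ (norm_nonneg _)
          rw [hQ, Finset.mem_Ico] at hm
          refine le_trans (Finset.sum_le_sum_of_subset_of_nonneg ?_ fun _ _ _ => norm_nonneg _)
            (hH m a (by omega) (by omega))
          intro n hn
          rw [Finset.mem_sdiff, Finset.mem_Icc] at hn
          refine Finset.mem_filter.2 ⟨hn.1, ?_⟩
          rw [abs_of_nonneg (by omega : (0 : ℤ) ≤ (m : ℤ) - a), lt_abs]
          omega
      _ ≤ 2 * H * ∑ m ∈ Q, ‖f m‖ := by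
          have hH0 : 0 ≤ H := le_trans (Finset.sum_nonneg fun _ _ => norm_nonneg _)
            (hH a a (by omega) (by omega))
          rw [← Finset.mul_sum]
          nlinarith

/-- The stopping-time construction by induction on the length: each half of an interval with
average at most `t` has average at most `2 * t`, so it is either a stopping interval or again of
small average. -/
theorem hasCZDecomp_of_small_average {A : ℕ → ℕ → ℂ} {E : Finset ℕ} {H t : ℝ} {M : ℕ}
    (ht : 0 < t)
    (hH : ∀ m l : ℕ, m < M → l < M →
      ∑ n ∈ E.filter (fun n : ℕ => 2 * |(m : ℤ) - l| < |(n : ℤ) - m|), ‖A n m - A n l‖ ≤ H)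
    (f : ℕ → ℂ) (k : ℕ) : ∀ a : ℕ, a + 2 ^ k ≤ M →
    ∑ m ∈ Finset.Ico a (a + 2 ^ k), ‖f m‖ ≤ t * 2 ^ k →
    HasCZDecomp A E H t f (Finset.Ico a (a + 2 ^ k)) := by
  induction k with
  | zero =>
    intro a haM h
    have hH0 : 0 ≤ H := le_trans (Finset.sum_nonneg fun _ _ => norm_nonneg _)
      (hH a a (by omega) (by omega))
    have hs : 0 ≤ ∑ m ∈ Finset.Ico a (a + 2 ^ 0), ‖f m‖ :=
      Finset.sum_nonneg fun _ _ => norm_nonneg _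
    refine ⟨f, ∅, ?_, le_rfl, by simp, by simp; positivity⟩
    intro m hm
    have hm' : m = a := by simp at hm; omega
    subst hm'
    simp at h
    linarith
  | succ k ih =>
    intro a haM h
    have e : a + 2 ^ (k + 1) = a + 2 ^ k + 2 ^ k := by rw [pow_succ]; omega
    have hk : 0 < 2 ^ k := by positivity
    have hu : Finset.Ico a (a + 2 ^ (k + 1)) =
        Finset.Ico a (a + 2 ^ k) ∪ Finset.Ico (a + 2 ^ k) (a + 2 ^ k + 2 ^ k) := by
      rw [e, Finset.Ico_union_Ico_eq_Ico (by omega) (by omega)]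
    have hd : Disjoint (Finset.Ico a (a + 2 ^ k))
        (Finset.Ico (a + 2 ^ k) (a + 2 ^ k + 2 ^ k)) := Finset.Ico_disjoint_Ico_consecutive _ _ _
    have half : ∀ b, b + 2 ^ k ≤ M →
        Finset.Ico b (b + 2 ^ k) ⊆ Finset.Ico a (a + 2 ^ (k + 1)) →
        HasCZDecomp A E H t f (Finset.Ico b (b + 2 ^ k)) := by
      intro b hb hsub
      by_cases hb' : ∑ m ∈ Finset.Ico b (b + 2 ^ k), ‖f m‖ ≤ t * 2 ^ k
      · exact ih b hb hb'
      · refine hasCZDecomp_of_large_average hH f hk hb ?_ ?_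
        · push_cast; linarith
        · refine (Finset.sum_le_sum_of_subset_of_nonneg hsub fun _ _ _ => norm_nonneg _).trans
            (h.trans (le_of_eq ?_))
          push_cast; ring
    rw [hu]
    refine HasCZDecomp.union ht.le hd (half a (by omega) ?_) (half (a + 2 ^ k) (by omega) ?_)
    · rw [hu]; exact Finset.subset_union_left
    · rw [hu]; exact Finset.subset_union_right

/-- Weak type (1,1) from an `ℓ²` bound and Hörmander's condition, for at most `2 ^ N` rows and
the columns below `2 ^ N`. The bound on the number of rows settles the levels `t` below the overall
average of `f`, where no decomposition is available. -/
theorem weak_type_of_hormander {A : ℕ → ℕ → ℂ} {E : Finset ℕ} {B H : ℝ} {N : ℕ} (hB : 0 ≤ B)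
    (hE : E.card ≤ 2 ^ N)
    (hL2 : ∀ g : ℕ → ℂ, ∑ n ∈ E, ‖∑ m ∈ Finset.range (2 ^ N), A n m * g m‖ ^ 2 ≤
      B * ∑ m ∈ Finset.range (2 ^ N), ‖g m‖ ^ 2)
    (hH : ∀ m l : ℕ, m < 2 ^ N → l < 2 ^ N →
      ∑ n ∈ E.filter (fun n : ℕ => 2 * |(m : ℤ) - l| < |(n : ℤ) - m|), ‖A n m - A n l‖ ≤ H)
    (f : ℕ → ℂ) {t : ℝ} (ht : 0 < t) :
    t * ((E.filter fun n => t < ‖∑ m ∈ Finset.range (2 ^ N), A n m * f m‖).card : ℝ) ≤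
      (7 + 4 * H + 8 * B) * ∑ m ∈ Finset.range (2 ^ N), ‖f m‖ := by
  have hpos : 0 < 2 ^ N := by positivity
  have hH0 : 0 ≤ H := le_trans (Finset.sum_nonneg fun _ _ => norm_nonneg _)
    (hH 0 0 hpos hpos)
  set X := ∑ m ∈ Finset.range (2 ^ N), ‖f m‖ with hX
  have hX0 : 0 ≤ X := Finset.sum_nonneg fun _ _ => norm_nonneg _
  by_cases hav : X ≤ t * 2 ^ N
  · have hQ : Finset.Ico 0 (0 + 2 ^ N) = Finset.range (2 ^ N) := by
      rw [zero_add, Finset.range_eq_Ico]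
    obtain ⟨g, Ω, h1, h2, h3, h4⟩ :=
      hasCZDecomp_of_small_average ht hH f N 0 (by omega) (by rw [hQ]; exact hav)
    rw [hQ] at h1 h2 h3 h4
    -- Outside `Ω`, either the good part exceeds `t / 2` (an `ℓ²` estimate, since `g` is bounded by
    -- `2 * t`) or the bad part does (an `ℓ¹` estimate).
    have hg := card_mul_le_of_sum_le E (fun n => ‖∑ m ∈ Finset.range (2 ^ N), A n m * g m‖ ^ 2)
      (fun _ _ => by positivity) (t := (t / 2) ^ 2) (hL2 g)
    have hb := card_mul_le_of_sum_le (E \ Ω)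
      (fun n => ‖∑ m ∈ Finset.range (2 ^ N), A n m * (f m - g m)‖)
      (fun _ _ => by positivity) (t := t / 2) h4
    set Eg := E.filter fun n => (t / 2) ^ 2 < ‖∑ m ∈ Finset.range (2 ^ N), A n m * g m‖ ^ 2
    set Eb := (E \ Ω).filter fun n =>
      t / 2 < ‖∑ m ∈ Finset.range (2 ^ N), A n m * (f m - g m)‖
    have hsub : (E.filter fun n => t < ‖∑ m ∈ Finset.range (2 ^ N), A n m * f m‖) ⊆
        Ω ∪ (Eb ∪ Eg) := by
      intro n hn
      obtain ⟨hnE, hn⟩ := Finset.mem_filter.1 hn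
      by_cases hΩ : n ∈ Ω
      · exact Finset.mem_union_left _ hΩ
      refine Finset.mem_union_right _ ?_
      by_cases hn' : t / 2 < ‖∑ m ∈ Finset.range (2 ^ N), A n m * (f m - g m)‖
      · exact Finset.mem_union_left _ (Finset.mem_filter.2 ⟨Finset.mem_sdiff.2 ⟨hnE, hΩ⟩, hn'⟩)
      · refine Finset.mem_union_right _ (Finset.mem_filter.2 ⟨hnE, ?_⟩)
        have e : ∑ m ∈ Finset.range (2 ^ N), A n m * f m =
            ∑ m ∈ Finset.range (2 ^ N), A n m * (f m - g m) +
            ∑ m ∈ Finset.range (2 ^ N), A n m * g m := by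
          rw [← Finset.sum_add_distrib]
          exact Finset.sum_congr rfl fun m _ => by ring
        have := norm_add_le (∑ m ∈ Finset.range (2 ^ N), A n m * (f m - g m))
          (∑ m ∈ Finset.range (2 ^ N), A n m * g m)
        rw [← e] at this
        exact pow_lt_pow_left₀ (by linarith) (by positivity) two_ne_zero
    have hc : (((E.filter fun n => t < ‖∑ m ∈ Finset.range (2 ^ N), A n m * f m‖).card : ℕ) : ℝ)
        ≤ Ω.card + (Eb.card + Eg.card) := by
      have h1 := Finset.card_le_card hsub
      have h2 := Finset.card_union_le Ω (Eb ∪ Eg)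
      have h3 := Finset.card_union_le Eb Eg
      exact_mod_cast h1.trans (h2.trans (by omega))
    have hg2 : ∑ m ∈ Finset.range (2 ^ N), ‖g m‖ ^ 2 ≤ 2 * t * X := by
      calc ∑ m ∈ Finset.range (2 ^ N), ‖g m‖ ^ 2
          ≤ ∑ m ∈ Finset.range (2 ^ N), 2 * t * ‖g m‖ :=
            Finset.sum_le_sum fun m hm => by
              rw [sq]; exact mul_le_mul_of_nonneg_right (h1 m hm) (norm_nonneg _)
        _ ≤ 2 * t * X := by rw [← Finset.mul_sum]; gcongr
    have hg3 : t * (Eg.card : ℝ) ≤ 8 * B * X := by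
      have h5 : (t / 2) ^ 2 * (Eg.card : ℝ) ≤ B * (2 * t * X) :=
        hg.trans (mul_le_mul_of_nonneg_left hg2 hB)
      refine le_of_mul_le_mul_left ?_ ht
      nlinarith
    calc _ ≤ t * ((Ω.card : ℝ) + (Eb.card + Eg.card)) := mul_le_mul_of_nonneg_left hc ht.le
      _ ≤ _ := by nlinarith
  · have h1 : ((E.filter fun n => t < ‖∑ m ∈ Finset.range (2 ^ N), A n m * f m‖).card : ℝ)
        ≤ 2 ^ N := by exact_mod_cast (Finset.card_filter_le _ _).trans hE
    have h2 := mul_le_mul_of_nonneg_left h1 ht.le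
    have h3 : 0 ≤ (6 + 4 * H + 8 * B) * X := by positivity
    push Not at hav
    linarith

/-! ### Hörmander's condition on a dyadic block -/

theorem sum_inv_sq_sub_le (s : Finset ℕ) (m D : ℕ) (hs : ∀ n ∈ s, (D : ℤ) < |(n : ℤ) - m|) :
    ∑ n ∈ s, (((m : ℝ) - n) ^ 2)⁻¹ ≤ 4 / ((D : ℝ) + 1) := by
  have half : ∀ (r : Finset ℕ) (φ : ℕ → ℕ), Set.InjOn φ r → (∀ n ∈ r, D < φ n) →
      ∑ n ∈ r, ((φ n : ℝ) ^ 2)⁻¹ ≤ 2 / ((D : ℝ) + 1) := by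
    intro r φ hφ hr
    rw [← Finset.sum_image (g := φ) (f := fun i : ℕ => ((i : ℝ) ^ 2)⁻¹) hφ]
    refine le_trans (Finset.sum_le_sum_of_subset_of_nonneg ?_ fun _ _ _ => by positivity)
      (sum_Ioo_inv_sq_le D ((r.image φ).sup id + 1))
    intro i hi
    obtain ⟨n, hn, rfl⟩ := Finset.mem_image.1 hi
    exact Finset.mem_Ioo.2 ⟨hr n hn, Nat.lt_succ_of_le (Finset.le_sup (f := id) hi)⟩
  rw [← Finset.sum_filter_add_sum_filter_not s (fun n => n < m)]
  have h1 : ∑ n ∈ s.filter (fun n => n < m), (((m : ℝ) - n) ^ 2)⁻¹ ≤ 2 / ((D : ℝ) + 1) := by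
    refine le_trans (le_of_eq (Finset.sum_congr rfl fun n hn => ?_))
      (half (s.filter fun n => n < m) (fun n => m - n) ?_ ?_)
    · rw [Nat.cast_sub (Finset.mem_filter.1 hn).2.le]
    · intro a ha b hb hab
      have := (Finset.mem_filter.1 ha).2
      have := (Finset.mem_filter.1 hb).2
      simp only at hab
      omega
    · intro n hn
      obtain ⟨h, h'⟩ := Finset.mem_filter.1 hn
      have := hs n h
      rw [lt_abs] at this
      omega
  have h2 : ∑ n ∈ s.filter (fun n => ¬ n < m), (((m : ℝ) - n) ^ 2)⁻¹ ≤ 2 / ((D : ℝ) + 1) := by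
    refine le_trans (le_of_eq (Finset.sum_congr rfl fun n hn => ?_))
      (half (s.filter fun n => ¬ n < m) (fun n => n - m) ?_ ?_)
    · rw [Nat.cast_sub (not_lt.1 (Finset.mem_filter.1 hn).2), ← neg_sub, neg_sq]
    · intro a ha b hb hab
      have := (Finset.mem_filter.1 ha).2
      have := (Finset.mem_filter.1 hb).2
      simp only at hab
      omega
    · intro n hn
      obtain ⟨h, h'⟩ := Finset.mem_filter.1 hn
      have := hs n h
      rw [lt_abs] at this
      omega
  calc _ ≤ 2 / ((D : ℝ) + 1) + 2 / ((D : ℝ) + 1) := add_le_add h1 h2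
    _ = _ := by ring

/-- Hörmander's condition for the rows `n ∈ [2^j, 2^(j+1))`, uniformly in `j`. Regularity is assumed
only for columns in `[n / 2, 3 * n / 2]`. If `m` or `l` lies outside, `|n - m|` and `|n - l|`
are both at least `n / 4`, so each row contributes `O(2^(-j))` and there are `2^j` of them. -/
theorem hormander_dyadic_block {A : ℕ → ℕ → ℂ} {C : ℝ} (hC : 0 ≤ C)
    (hsize : ∀ n m : ℕ, n ≠ m → ‖A n m‖ ≤ C / |(n : ℝ) - m|)
    (hdiff : ∀ n m l : ℕ, 2 * |(m : ℝ) - l| < |(m : ℝ) - n| →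
      (n : ℝ) / 2 ≤ m → (m : ℝ) ≤ 3 * n / 2 → (n : ℝ) / 2 ≤ l → (l : ℝ) ≤ 3 * n / 2 →
      ‖A n m - A n l‖ ≤ C * (|(m : ℝ) - l| / ((m : ℝ) - n) ^ 2))
    (j m l : ℕ) :
    ∑ n ∈ (Finset.Ico (2 ^ j) (2 ^ (j + 1))).filter
      (fun n : ℕ => 2 * |(m : ℤ) - l| < |(n : ℤ) - m|), ‖A n m - A n l‖ ≤ 8 * C := by
  set E := (Finset.Ico (2 ^ j) (2 ^ (j + 1))).filter
      (fun n : ℕ => 2 * |(m : ℤ) - l| < |(n : ℤ) - m|) with hE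
  have hpt : ∀ n ∈ E, ‖A n m - A n l‖ ≤
      C * |(m : ℝ) - l| * (((m : ℝ) - n) ^ 2)⁻¹ + 6 * C / 2 ^ j := by
    intro n hn
    obtain ⟨hn1, hn2⟩ := Finset.mem_filter.1 hn
    have hjn : (2 : ℝ) ^ j ≤ n := by exact_mod_cast (Finset.mem_Ico.1 hn1).1
    have hj : (0 : ℝ) < 2 ^ j := by positivity
    have hn0 : (0 : ℝ) < n := hj.trans_le hjn
    have hfar : 2 * |(m : ℝ) - l| < |(n : ℝ) - m| := by exact_mod_cast hn2
    have hfirst : 0 ≤ C * |(m : ℝ) - l| * (((m : ℝ) - n) ^ 2)⁻¹ := by positivity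
    -- Away from the local region both entries are controlled by the size bound alone.
    have global : (n : ℝ) / 3 ≤ |(n : ℝ) - m| → (n : ℝ) / 4 ≤ |(n : ℝ) - l| →
        1 / |(n : ℝ) - m| + 1 / |(n : ℝ) - l| ≤ 6 / n →
        ‖A n m - A n l‖ ≤ C * |(m : ℝ) - l| * (((m : ℝ) - n) ^ 2)⁻¹ + 6 * C / 2 ^ j := by
      intro h1 h2 h3
      have hnm : n ≠ m := by rintro rfl; simp at h1; linarith
      have hnl : n ≠ l := by rintro rfl; simp at h2; linarith
      have h4 : ‖A n m - A n l‖ ≤ C * (1 / |(n : ℝ) - m| + 1 / |(n : ℝ) - l|) := by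
        refine (norm_sub_le _ _).trans ((add_le_add (hsize n m hnm) (hsize n l hnl)).trans ?_)
        rw [mul_add, mul_one_div, mul_one_div]
      have h5 : (6 : ℝ) / n ≤ 6 / 2 ^ j := by gcongr
      have h6 := mul_le_mul_of_nonneg_left (h3.trans h5) hC
      have h7 : 6 * C / 2 ^ j = C * (6 / 2 ^ j) := by ring
      linarith
    have inv_bd : ∀ {x c : ℝ}, 0 < c → (n : ℝ) / c ≤ x → 1 / x ≤ c / n := by
      intro x c hc hx
      have : 0 < (n : ℝ) / c := by positivity
      calc 1 / x ≤ 1 / ((n : ℝ) / c) := one_div_le_one_div_of_le this hx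
        _ = c / n := one_div_div _ _
    have tri : |(n : ℝ) - m| ≤ |(n : ℝ) - l| + |(m : ℝ) - l| := by
      rw [abs_sub_comm (m : ℝ) l]; exact abs_sub_le _ _ _
    have tri' : |(n : ℝ) - l| ≤ |(n : ℝ) - m| + |(m : ℝ) - l| := abs_sub_le _ _ _
    by_cases hm : (n : ℝ) / 2 ≤ m ∧ (m : ℝ) ≤ 3 * n / 2
    · by_cases hl : (n : ℝ) / 2 ≤ l ∧ (l : ℝ) ≤ 3 * n / 2
      · have := hdiff n m l (by rwa [abs_sub_comm (m : ℝ) n]) hm.1 hm.2 hl.1 hl.2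
        have h6 : 0 ≤ 6 * C / 2 ^ j := by positivity
        rw [div_eq_mul_inv, ← mul_assoc] at this
        linarith
      · have h1 : (n : ℝ) / 2 ≤ |(n : ℝ) - l| := by
          rw [le_abs]
          by_contra! h
          exact hl ⟨by linarith, by linarith⟩
        have h2 : (n : ℝ) / 3 ≤ |(n : ℝ) - m| := by linarith
        refine global h2 (by linarith) ?_
        have := inv_bd (by norm_num) h1
        have := inv_bd (by norm_num) h2
        have h3 : (6 : ℝ) / n = 2 / n + 3 / n + 1 / n := by ring
        have h4 : 0 < 1 / (n : ℝ) := by positivity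
        linarith
    · have h1 : (n : ℝ) / 2 ≤ |(n : ℝ) - m| := by
        rw [le_abs]
        by_contra! h
        exact hm ⟨by linarith, by linarith⟩
      have h2 : (n : ℝ) / 4 ≤ |(n : ℝ) - l| := by linarith
      refine global (by linarith) h2 ?_
      have := inv_bd (by norm_num) h1
      have := inv_bd (by norm_num) h2
      have h3 : (6 : ℝ) / n = 2 / n + 4 / n := by ring
      linarith
  have hcard : (E.card : ℝ) ≤ 2 ^ j := by
    have h := Finset.card_filter_le (Finset.Ico (2 ^ j) (2 ^ (j + 1)))
      (fun n : ℕ => 2 * |(m : ℤ) - l| < |(n : ℤ) - m|)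
    rw [Nat.card_Ico, pow_succ] at h
    have : E.card ≤ 2 ^ j := by rw [hE, pow_succ]; omega
    exact_mod_cast this
  have hinv := sum_inv_sq_sub_le E m (2 * ((m : ℤ) - l).natAbs) fun n hn => by
    have := (Finset.mem_filter.1 hn).2
    push_cast
    exact this
  have hd : (((2 * ((m : ℤ) - l).natAbs : ℕ)) : ℝ) = 2 * |(m : ℝ) - l| := by
    rw [Nat.cast_mul, Nat.cast_natAbs]; push_cast; ring
  rw [hd] at hinv
  calc ∑ n ∈ E, ‖A n m - A n l‖
      ≤ ∑ n ∈ E, (C * |(m : ℝ) - l| * (((m : ℝ) - n) ^ 2)⁻¹ + 6 * C / 2 ^ j) :=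
        Finset.sum_le_sum hpt
    _ = C * |(m : ℝ) - l| * ∑ n ∈ E, (((m : ℝ) - n) ^ 2)⁻¹ + E.card * (6 * C / 2 ^ j) := by
        rw [Finset.sum_add_distrib, ← Finset.mul_sum, Finset.sum_const, nsmul_eq_mul]
    _ ≤ C * |(m : ℝ) - l| * (4 / (2 * |(m : ℝ) - l| + 1)) + 2 ^ j * (6 * C / 2 ^ j) := by
        gcongr
    _ ≤ 2 * C + 6 * C := by
        have h0 : 0 ≤ |(m : ℝ) - l| := abs_nonneg _
        have h1 : |(m : ℝ) - l| * (4 / (2 * |(m : ℝ) - l| + 1)) ≤ 2 := by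
          rw [mul_div_assoc', div_le_iff₀ (by positivity)]; linarith
        have h2 : (2 : ℝ) ^ j * (6 * C / 2 ^ j) = 6 * C := by field_simp
        rw [h2, mul_assoc]
        nlinarith
    _ = 8 * C := by ring

/-! ### Weak type (1,1) for the whole matrix -/

/-- The dyadic scale of `l`, measured by `Nat.log 2 l`, differs from `j` by at most one. As
`Nat.log 2 0 = 0`, the number `0` counts as a number of scale `0`. -/
def NearScale (j l : ℕ) : Prop := Nat.log 2 l ≤ j + 1 ∧ j ≤ Nat.log 2 l + 1

instance (j : ℕ) : DecidablePred (NearScale j) := fun l =>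
  inferInstanceAs (Decidable (Nat.log 2 l ≤ j + 1 ∧ j ≤ Nat.log 2 l + 1))

theorem NearScale.lt_two_pow {j l : ℕ} (h : NearScale j l) : l < 2 ^ (j + 2) :=
  (Nat.lt_pow_succ_log_self one_lt_two l).trans_le
    (Nat.pow_le_pow_right two_pos (by have := h.1; omega))

theorem two_mul_le_of_not_nearScale {a b : ℕ} (ha : a ≠ 0) (hb : b ≠ 0)
    (h : ¬ NearScale (Nat.log 2 a) b) : 2 * a ≤ b ∨ 2 * b ≤ a := by
  have key : ∀ {x y : ℕ}, y ≠ 0 → Nat.log 2 x + 1 < Nat.log 2 y → 2 * x ≤ y := by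
    intro x y hy hxy
    have h1 := Nat.lt_pow_succ_log_self one_lt_two x
    have h2 := Nat.pow_log_le_self 2 hy
    have h3 : 2 ^ (Nat.log 2 x + 1 + 1) ≤ 2 ^ Nat.log 2 y := Nat.pow_le_pow_right two_pos hxy
    rw [pow_succ] at h3
    omega
  unfold NearScale at h
  rcases le_or_gt (Nat.log 2 b) (Nat.log 2 a + 1) with h' | h'
  · exact Or.inr (key ha (by omega))
  · exact Or.inl (key hb h')

/-- The part of the matrix where row and column have comparable dyadic scale is of weak type (1,1):
the rows split into dyadic blocks, and each column is used by at most three of them. -/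
theorem weak_type_near_diagonal {A : ℕ → ℕ → ℂ} {B C : ℝ} (hB : 0 ≤ B) (hC : 0 ≤ C)
    (hL2 : ∀ (F S : Finset ℕ) (g : ℕ → ℂ), ∑ n ∈ F, ‖∑ m ∈ S, A n m * g m‖ ^ 2 ≤
      B * ∑ m ∈ S, ‖g m‖ ^ 2)
    (hsize : ∀ n m : ℕ, n ≠ m → ‖A n m‖ ≤ C / |(n : ℝ) - m|)
    (hdiff : ∀ n m l : ℕ, 2 * |(m : ℝ) - l| < |(m : ℝ) - n| →
      (n : ℝ) / 2 ≤ m → (m : ℝ) ≤ 3 * n / 2 → (n : ℝ) / 2 ≤ l → (l : ℝ) ≤ 3 * n / 2 →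
      ‖A n m - A n l‖ ≤ C * (|(m : ℝ) - l| / ((m : ℝ) - n) ^ 2))
    (F S : Finset ℕ) (hF : 0 ∉ F) (f : ℕ → ℂ) {t : ℝ} (ht : 0 < t) :
    t * ((F.filter fun n =>
      t < ‖∑ m ∈ S.filter (NearScale (Nat.log 2 n)), A n m * f m‖).card : ℝ) ≤
      3 * (7 + 32 * C + 8 * B) * ∑ m ∈ S, ‖f m‖ := by
  classical
  set h : ℕ → ℕ → ℂ := fun j m => if m ∈ S.filter (NearScale j) then f m else 0 with hh
  set G : ℕ → Finset ℕ := fun j => (Finset.Ico (2 ^ j) (2 ^ (j + 1))).filter fun n =>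
    t < ‖∑ m ∈ Finset.range (2 ^ (j + 2)), A n m * h j m‖ with hG
  have hinter : ∀ j, Finset.range (2 ^ (j + 2)) ∩ S.filter (NearScale j) =
      S.filter (NearScale j) := fun j =>
    Finset.inter_eq_right.2 fun m hm =>
      Finset.mem_range.2 (Finset.mem_filter.1 hm).2.lt_two_pow
  have hsumA : ∀ j n, ∑ m ∈ Finset.range (2 ^ (j + 2)), A n m * h j m =
      ∑ m ∈ S.filter (NearScale j), A n m * f m := by
    intro j n
    simp only [hh, mul_ite, mul_zero]
    rw [Finset.sum_ite_mem, hinter]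
  have hsumN : ∀ j, ∑ m ∈ Finset.range (2 ^ (j + 2)), ‖h j m‖ =
      ∑ m ∈ S.filter (NearScale j), ‖f m‖ := by
    intro j
    simp only [hh, apply_ite norm, norm_zero]
    rw [Finset.sum_ite_mem, hinter]
  set J := F.image (Nat.log 2) with hJ
  have hsub : (F.filter fun n =>
      t < ‖∑ m ∈ S.filter (NearScale (Nat.log 2 n)), A n m * f m‖) ⊆ J.biUnion G := by
    intro n hn
    obtain ⟨hnF, hn⟩ := Finset.mem_filter.1 hn
    have hn0 : n ≠ 0 := fun h => hF (h ▸ hnF)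
    refine Finset.mem_biUnion.2 ⟨Nat.log 2 n, Finset.mem_image_of_mem _ hnF,
      Finset.mem_filter.2 ⟨Finset.mem_Ico.2 ⟨Nat.pow_log_le_self 2 hn0,
        Nat.lt_pow_succ_log_self one_lt_two n⟩, ?_⟩⟩
    rwa [hsumA]
  have hcard : ((F.filter fun n =>
      t < ‖∑ m ∈ S.filter (NearScale (Nat.log 2 n)), A n m * f m‖).card : ℝ) ≤
      ∑ j ∈ J, ((G j).card : ℝ) := by
    exact_mod_cast (Finset.card_le_card hsub).trans Finset.card_biUnion_le
  have hW : 0 ≤ 7 + 32 * C + 8 * B := by positivity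
  have hblock : ∀ j, t * ((G j).card : ℝ) ≤
      (7 + 32 * C + 8 * B) * ∑ m ∈ S.filter (NearScale j), ‖f m‖ := by
    intro j
    have := weak_type_of_hormander (A := A) (E := Finset.Ico (2 ^ j) (2 ^ (j + 1)))
      (N := j + 2) (H := 8 * C) hB ?_ (fun g => hL2 _ _ g)
      (fun m l _ _ => hormander_dyadic_block hC hsize hdiff j m l) (h j) ht
    · rw [hsumN] at this
      refine this.trans (le_of_eq ?_)
      ring
    · rw [Nat.card_Ico]
      exact (Nat.sub_le _ _).trans (Nat.pow_le_pow_right two_pos (by omega))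
  calc _ ≤ t * ∑ j ∈ J, ((G j).card : ℝ) := mul_le_mul_of_nonneg_left hcard ht.le
    _ = ∑ j ∈ J, t * ((G j).card : ℝ) := Finset.mul_sum _ _ _
    _ ≤ ∑ j ∈ J, (7 + 32 * C + 8 * B) * ∑ m ∈ S.filter (NearScale j), ‖f m‖ :=
        Finset.sum_le_sum fun j _ => hblock j
    _ = (7 + 32 * C + 8 * B) * ∑ m ∈ S, ∑ j ∈ J, if NearScale j m then ‖f m‖ else 0 := by
        rw [← Finset.mul_sum, Finset.sum_comm]
        simp only [Finset.sum_filter]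
    _ ≤ (7 + 32 * C + 8 * B) * ∑ m ∈ S, 3 * ‖f m‖ := by
        refine mul_le_mul_of_nonneg_left (Finset.sum_le_sum fun m _ => ?_) hW
        rw [← Finset.sum_filter, Finset.sum_const, nsmul_eq_mul]
        refine mul_le_mul_of_nonneg_right ?_ (norm_nonneg _)
        have hs : J.filter (fun j => NearScale j m) ⊆
            Finset.Icc (Nat.log 2 m - 1) (Nat.log 2 m + 1) := by
          intro j hj
          obtain ⟨_, h1, h2⟩ := Finset.mem_filter.1 hj
          exact Finset.mem_Icc.2 ⟨by omega, h2⟩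
        have := Finset.card_le_card hs
        rw [Nat.card_Icc] at this
        exact_mod_cast this.trans (by omega)
    _ = _ := by rw [← Finset.mul_sum]; ring

/-- A matrix indexed by `ℤ` whose finite sections are bounded on `ℓ²` (with squared norm at most
`B`), whose entries are bounded, and which satisfies size and regularity estimates in the column
variable, the latter only for columns comparable to the row in absolute value. -/
structure IsCZMatrix (A : ℤ → ℤ → ℂ) (B C : ℝ) : Prop where
  l2_bound : ∀ (F S : Finset ℤ) (g : ℤ → ℂ), ∑ n ∈ F, ‖∑ m ∈ S, A n m * g m‖ ^ 2 ≤
    B * ∑ m ∈ S, ‖g m‖ ^ 2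
  entry_le : ∀ n m, ‖A n m‖ ≤ C
  size_le : ∀ n m : ℤ, |n| ≠ |m| → ‖A n m‖ ≤ C / |(n : ℝ) - m|
  diff_le : ∀ n m l : ℤ,
    2 * |(m : ℝ) - l| < |(|(m : ℝ)| - |(n : ℝ)|)| →
    |(n : ℝ)| / 2 ≤ |(m : ℝ)| → |(m : ℝ)| ≤ 3 * |(n : ℝ)| / 2 →
    |(n : ℝ)| / 2 ≤ |(l : ℝ)| → |(l : ℝ)| ≤ 3 * |(n : ℝ)| / 2 →
    ‖A n m - A n l‖ ≤ C * (|(m : ℝ) - l| / (|(m : ℝ)| - |(n : ℝ)|) ^ 2)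

/-- The embedding `k ↦ s * k` of `ℕ` as a half-line in `ℤ`, for a sign `s`. -/
def signEmb (s : ℤˣ) : ℕ ↪ ℤ where
  toFun k := s * k
  inj' a b h := by
    have := mul_left_cancel₀ s.ne_zero h
    exact_mod_cast this

/-- The columns in `S` that have the sign of `n` and a comparable dyadic scale. There are none for
`n = 0`. -/
def nearDiag (S : Finset ℤ) (n : ℤ) : Finset ℤ :=
  S.filter fun m => 0 < n * m ∧ NearScale (Nat.log 2 n.natAbs) m.natAbs

/-- Transfer of `weak_type_near_diagonal` to the rows of one sign. -/
theorem weak_type_nearDiag_half {A : ℤ → ℤ → ℂ} {B C : ℝ} (hA : IsCZMatrix A B C) (hB : 0 ≤ B)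
    (hC : 0 ≤ C) (s : ℤˣ) (F S : Finset ℤ) (hF : ∀ n ∈ F, 0 < (s : ℤ) * n) (f : ℤ → ℂ) {t : ℝ}
    (ht : 0 < t) :
    t * ((F.filter fun n => t < ‖∑ m ∈ nearDiag S n, A n m * f m‖).card : ℝ) ≤
      3 * (7 + 32 * C + 8 * B) * ∑ m ∈ S, ‖f m‖ := by
  classical
  set e := signEmb s with he
  have hs : (s : ℤ) = 1 ∨ (s : ℤ) = -1 := by
    rcases Int.units_eq_one_or s with h | h <;> simp [h]
  have hse : ∀ k : ℕ, e k = s * k := fun _ => rfl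
  have habs : ∀ k : ℕ, |((e k : ℤ) : ℝ)| = k := by
    intro k; rw [hse]; rcases hs with h | h <;> simp [h]
  have hsub : ∀ a b : ℕ, |((e a : ℤ) : ℝ) - e b| = |(a : ℝ) - b| := by
    intro a b; rw [hse, hse]
    rcases hs with h | h
    · simp [h]
    · rw [h]; push_cast
      rw [← abs_neg]; congr 1; ring
  have hnat : ∀ k : ℕ, (e k).natAbs = k := by
    intro k; rw [hse]; rcases hs with h | h <;> simp [h]
  have hinv : ∀ n : ℤ, 0 < (s : ℤ) * n → e n.natAbs = n := by
    intro n hn; rw [hse]; rcases hs with h | h <;> rw [h] at hn ⊢ <;> omega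
  have himg : ∀ R : Finset ℤ, (∀ n ∈ R, 0 < (s : ℤ) * n) → (R.image Int.natAbs).map e = R := by
    intro R hR
    ext n
    simp only [Finset.mem_map, Finset.mem_image]
    constructor
    · rintro ⟨_, ⟨m, hm, rfl⟩, rfl⟩
      rwa [hinv m (hR m hm)]
    · intro hn
      exact ⟨_, ⟨n, hn, rfl⟩, hinv n (hR n hn)⟩
  set S' := (S.filter fun m => 0 < (s : ℤ) * m).image Int.natAbs with hS'
  have hS'e : S'.map e = S.filter fun m => 0 < (s : ℤ) * m :=
    himg _ fun m hm => (Finset.mem_filter.1 hm).2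
  have hF0 : 0 ∉ F.image Int.natAbs := by
    intro h
    obtain ⟨n, hn, h⟩ := Finset.mem_image.1 h
    have := hF n hn
    rw [Int.natAbs_eq_zero.1 h] at this
    simp at this
  have main := weak_type_near_diagonal (A := fun n m => A (e n) (e m)) hB hC ?_ ?_ ?_
    (F.image Int.natAbs) S' hF0 (fun m => f (e m)) ht
  · have hX : ∑ m ∈ S', ‖f (e m)‖ ≤ ∑ m ∈ S, ‖f m‖ := by
      rw [← Finset.sum_map S' e (fun m => ‖f m‖), hS'e]
      exact Finset.sum_le_sum_of_subset_of_nonneg (Finset.filter_subset _ _)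
        fun _ _ _ => norm_nonneg _
    have hcard : (F.filter fun n => t < ‖∑ m ∈ nearDiag S n, A n m * f m‖).card ≤
        ((F.image Int.natAbs).filter fun n =>
          t < ‖∑ m ∈ S'.filter (NearScale (Nat.log 2 n)), A (e n) (e m) * f (e m)‖).card := by
      refine Finset.card_le_card_of_injOn Int.natAbs ?_ ?_
      · intro n hn
        obtain ⟨hnF, hn⟩ := Finset.mem_filter.1 hn
        refine Finset.mem_filter.2 ⟨Finset.mem_image_of_mem _ hnF, ?_⟩
        have h1 : (S'.filter (NearScale (Nat.log 2 n.natAbs))).map e = nearDiag S n := by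
          ext m
          simp only [nearDiag, Finset.mem_map, Finset.mem_filter]
          have hn0 := hF n hnF
          have hiff : 0 < n * m ↔ 0 < (s : ℤ) * m := by
            rcases hs with h | h <;> rw [h] at hn0 ⊢
            · rw [one_mul] at hn0 ⊢; exact mul_pos_iff_of_pos_left hn0
            · rw [neg_one_mul] at hn0 ⊢
              constructor
              · intro h; by_contra! h'; nlinarith
              · intro h; nlinarith
          rw [hiff]
          constructor
          · rintro ⟨k, ⟨hk, hk'⟩, rfl⟩
            have : e k ∈ S'.map e := Finset.mem_map_of_mem _ hk
            rw [hS'e, Finset.mem_filter] at this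
            exact ⟨this.1, this.2, by rwa [hnat]⟩
          · rintro ⟨h1, h2, h3⟩
            exact ⟨m.natAbs, ⟨Finset.mem_image_of_mem _ (Finset.mem_filter.2 ⟨h1, h2⟩), h3⟩,
              hinv m h2⟩
        have h2 := Finset.sum_map (S'.filter (NearScale (Nat.log 2 n.natAbs))) e
          (fun m => A n m * f m)
        rw [h1] at h2
        rw [hinv n (hF n hnF), ← h2]
        exact hn
      · intro a ha b hb hab
        rw [← hinv a (hF a (Finset.mem_filter.1 ha).1), ← hinv b (hF b (Finset.mem_filter.1 hb).1),
          hab]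
    refine le_trans (mul_le_mul_of_nonneg_left (Nat.cast_le.2 hcard) ht.le) (main.trans ?_)
    exact mul_le_mul_of_nonneg_left hX (by positivity)
  · intro F S g
    have := hA.l2_bound (F.map e) (S.map e) (fun m => g m.natAbs)
    simpa only [Finset.sum_map, hnat] using this
  · intro n m hnm
    have := hA.size_le (e n) (e m) ?_
    · rwa [hsub] at this
    · intro h
      have h' : |((e n : ℤ) : ℝ)| = |((e m : ℤ) : ℝ)| := by exact_mod_cast h
      rw [habs, habs] at h'
      exact hnm (by exact_mod_cast h')
  · intro n m l
    have := hA.diff_le (e n) (e m) (e l)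
    simpa only [habs, hsub] using this

theorem weak_type_nearDiag {A : ℤ → ℤ → ℂ} {B C : ℝ} (hA : IsCZMatrix A B C) (hB : 0 ≤ B)
    (hC : 0 ≤ C) (F S : Finset ℤ) (hF : 0 ∉ F) (f : ℤ → ℂ) {t : ℝ} (ht : 0 < t) :
    t * ((F.filter fun n => t < ‖∑ m ∈ nearDiag S n, A n m * f m‖).card : ℝ) ≤
      6 * (7 + 32 * C + 8 * B) * ∑ m ∈ S, ‖f m‖ := by
  classical
  have h1 := weak_type_nearDiag_half hA hB hC 1 (F.filter fun n => 0 < n) S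
    (fun n hn => by simpa using (Finset.mem_filter.1 hn).2) f ht
  have h2 := weak_type_nearDiag_half hA hB hC (-1) (F.filter fun n => n < 0) S
    (fun n hn => by simpa using (Finset.mem_filter.1 hn).2) f ht
  set P := fun n => t < ‖∑ m ∈ nearDiag S n, A n m * f m‖
  have hsub : F.filter P ⊆
      (F.filter fun n => 0 < n).filter P ∪ (F.filter fun n => n < 0).filter P := by
    intro n hn
    obtain ⟨hnF, hn⟩ := Finset.mem_filter.1 hn
    have : n ≠ 0 := fun h => hF (h ▸ hnF)
    rcases lt_or_gt_of_ne this with h | h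
    · exact Finset.mem_union_right _ (Finset.mem_filter.2 ⟨Finset.mem_filter.2 ⟨hnF, h⟩, hn⟩)
    · exact Finset.mem_union_left _ (Finset.mem_filter.2 ⟨Finset.mem_filter.2 ⟨hnF, h⟩, hn⟩)
  have hc : ((F.filter P).card : ℝ) ≤ ((F.filter fun n => 0 < n).filter P).card +
      ((F.filter fun n => n < 0).filter P).card := by
    exact_mod_cast (Finset.card_le_card hsub).trans (Finset.card_union_le _ _)
  have := mul_le_mul_of_nonneg_left hc ht.le
  linarith

theorem card_abs_lt_le (F : Finset ℤ) (hF : 0 ∉ F) {R : ℝ} (hR : 0 ≤ R) :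
    ((F.filter fun n : ℤ => |(n : ℝ)| < R).card : ℝ) ≤ 2 * R := by
  have hsub : (F.filter fun n : ℤ => |(n : ℝ)| < R) ⊆
      (Finset.Icc (-(⌊R⌋₊ : ℤ)) ⌊R⌋₊).erase 0 := by
    intro n hn
    obtain ⟨hnF, hn⟩ := Finset.mem_filter.1 hn
    refine Finset.mem_erase.2 ⟨fun h => hF (h ▸ hnF), ?_⟩
    have : n.natAbs ≤ ⌊R⌋₊ := Nat.le_floor (by rw [Nat.cast_natAbs]; push_cast; exact hn.le)
    exact Finset.mem_Icc.2 ⟨by omega, by omega⟩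
  have h1 := Finset.card_le_card hsub
  rw [Finset.card_erase_of_mem (Finset.mem_Icc.2 ⟨by omega, by omega⟩), Int.card_Icc] at h1
  have h2 : (F.filter fun n : ℤ => |(n : ℝ)| < R).card ≤ 2 * ⌊R⌋₊ := by omega
  calc _ ≤ ((2 * ⌊R⌋₊ : ℕ) : ℝ) := by exact_mod_cast h2
    _ ≤ 2 * R := by push_cast; linarith [Nat.floor_le hR]

/-- Off the antidiagonal, a column that differs from `n` in sign or in dyadic scale has distance at
least `|n| / 2` from `n`. -/
theorem IsCZMatrix.entry_le_far {A : ℤ → ℤ → ℂ} {B C : ℝ} (hA : IsCZMatrix A B C) (hC : 0 ≤ C)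
    {n m : ℤ} (hn : n ≠ 0) (hmn : m ≠ -n)
    (hfar : ¬ (0 < n * m ∧ NearScale (Nat.log 2 n.natAbs) m.natAbs)) :
    ‖A n m‖ ≤ 2 * C / |(n : ℝ)| := by
  have hne : m ≠ n := by
    rintro rfl
    exact hfar ⟨mul_self_pos.2 hn, Nat.le_succ _, Nat.le_succ _⟩
  have hd : n.natAbs ≤ 2 * (n - m).natAbs := by
    by_cases hs : 0 < n * m
    · have hm : m ≠ 0 := by rintro rfl; simp at hs
      have h := two_mul_le_of_not_nearScale (Int.natAbs_ne_zero.2 hn) (Int.natAbs_ne_zero.2 hm)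
        fun h => hfar ⟨hs, h⟩
      omega
    · have : 0 ≤ n ∧ m ≤ 0 ∨ n ≤ 0 ∧ 0 ≤ m := by
        by_contra! h
        rcases lt_or_gt_of_ne hn with h' | h'
        · exact hs (mul_pos_of_neg_of_neg h' (h.2 h'.le))
        · exact hs (mul_pos h' (h.1 h'.le))
      omega
  have hn' : 0 < |(n : ℝ)| := by positivity
  have hd' : |(n : ℝ)| ≤ 2 * |(n : ℝ) - m| := by
    have h : |n| ≤ 2 * |n - m| := by
      rw [Int.abs_eq_natAbs, Int.abs_eq_natAbs]
      exact_mod_cast hd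
    exact_mod_cast h
  refine (hA.size_le n m ?_).trans ?_
  · intro h
    rcases abs_eq_abs.1 h with h | h <;> omega
  · rw [div_le_div_iff₀ (by linarith) hn']
    nlinarith

theorem IsCZMatrix.weak_type {A : ℤ → ℤ → ℂ} {B C : ℝ} (hA : IsCZMatrix A B C) (hB : 0 ≤ B)
    (hC : 0 ≤ C) (F S : Finset ℤ) (f : ℤ → ℂ) {t : ℝ} (ht : 0 < t) :
    t * ((F.filter fun n => t < ‖∑ m ∈ S, A n m * f m‖).card : ℝ) ≤
      (18 * (7 + 32 * C + 8 * B) + 16 * C) * ∑ m ∈ S, ‖f m‖ := by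
  classical
  set X := ∑ m ∈ S, ‖f m‖ with hX
  have hX0 : 0 ≤ X := Finset.sum_nonneg fun _ _ => norm_nonneg _
  have ht3 : 0 < t / 3 := by positivity
  have hbdd : ∀ {c : ℝ} (n : ℤ) (R : Finset ℤ), 0 ≤ c → R ⊆ S → (∀ m ∈ R, ‖A n m‖ ≤ c) →
      ‖∑ m ∈ R, A n m * f m‖ ≤ c * X := by
    intro c n R hc hR h
    calc ‖∑ m ∈ R, A n m * f m‖ ≤ ∑ m ∈ R, c * ‖f m‖ :=
          (norm_sum_le _ _).trans (Finset.sum_le_sum fun m hm => by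
            rw [norm_mul]; exact mul_le_mul_of_nonneg_right (h m hm) (norm_nonneg _))
      _ ≤ ∑ m ∈ S, c * ‖f m‖ :=
          Finset.sum_le_sum_of_subset_of_nonneg hR fun _ _ _ => by positivity
      _ = c * X := (Finset.mul_sum _ _ _).symm
  set F' := F.erase 0 with hF'
  have hF0 : 0 ∉ F' := Finset.notMem_erase 0 F
  -- A row where the sum exceeds `t` is the row `0`, or one of the three parts of the row exceeds
  -- `t / 3`. The third part is at most `2 * C * X / |n|`, which exceeds `t / 3` only in `E3`.
  set E0 := ({0} : Finset ℤ).filter fun n => t < ‖∑ m ∈ S, A n m * f m‖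
  set E1 := F'.filter fun n => t / 3 < ‖∑ m ∈ nearDiag S n, A n m * f m‖
  set E2 := F'.filter fun n => t / 3 < ∑ m ∈ S, if m = -n then C * ‖f m‖ else 0
  set E3 := F'.filter fun n : ℤ => |(n : ℝ)| < 6 * C * X / t
  have b0 : t * (E0.card : ℝ) ≤ C * X := by
    by_cases h0 : t < ‖∑ m ∈ S, A 0 m * f m‖
    · have : E0.card ≤ 1 := (Finset.card_filter_le _ _).trans (by simp)
      have h1 : (E0.card : ℝ) ≤ 1 := by exact_mod_cast this
      have h2 := hbdd 0 S hC le_rfl fun m _ => hA.entry_le 0 m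
      nlinarith
    · have : E0 = ∅ := by
        refine Finset.filter_eq_empty_iff.2 fun {n} hn => ?_
        rwa [Finset.mem_singleton.1 hn]
      rw [this]; simp; positivity
  have b1 : t / 3 * (E1.card : ℝ) ≤ 6 * (7 + 32 * C + 8 * B) * X :=
    weak_type_nearDiag hA hB hC F' S hF0 f ht3
  have b2 : t / 3 * (E2.card : ℝ) ≤ C * X := by
    refine card_mul_le_of_sum_le F' _
      (fun n _ => Finset.sum_nonneg fun m _ => by split_ifs <;> positivity) ?_
    rw [Finset.sum_comm, hX, Finset.mul_sum]
    refine Finset.sum_le_sum fun m _ => ?_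
    have : ∀ n : ℤ, (m = -n) = (-m = n) := fun n => propext (by omega)
    simp only [this]
    rw [Finset.sum_ite_eq]
    split_ifs
    · exact le_rfl
    · positivity
  have b3 : t * (E3.card : ℝ) ≤ 12 * C * X := by
    have := card_abs_lt_le F' hF0 (R := 6 * C * X / t) (by positivity)
    calc t * (E3.card : ℝ) ≤ t * (2 * (6 * C * X / t)) := mul_le_mul_of_nonneg_left this ht.le
      _ = _ := by field_simp; ring
  have hsub : (F.filter fun n => t < ‖∑ m ∈ S, A n m * f m‖) ⊆ E0 ∪ (E1 ∪ (E2 ∪ E3)) := by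
    intro n hn
    obtain ⟨hnF, hn⟩ := Finset.mem_filter.1 hn
    by_cases hn0 : n = 0
    · subst hn0
      exact Finset.mem_union_left _ (Finset.mem_filter.2 ⟨Finset.mem_singleton_self _, hn⟩)
    refine Finset.mem_union_right _ ?_
    have hnF' : n ∈ F' := Finset.mem_erase.2 ⟨hn0, hnF⟩
    by_contra hcon
    simp only [Finset.mem_union, not_or] at hcon
    obtain ⟨h1, h2, h3⟩ := hcon
    have h1' : ‖∑ m ∈ nearDiag S n, A n m * f m‖ ≤ t / 3 :=
      not_lt.1 fun h => h1 (Finset.mem_filter.2 ⟨hnF', h⟩)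
    have h2' : (∑ m ∈ S, if m = -n then C * ‖f m‖ else 0) ≤ t / 3 :=
      not_lt.1 fun h => h2 (Finset.mem_filter.2 ⟨hnF', h⟩)
    have h3' : 6 * C * X / t ≤ |(n : ℝ)| :=
      not_lt.1 fun h => h3 (Finset.mem_filter.2 ⟨hnF', h⟩)
    have hnpos : 0 < |(n : ℝ)| := by positivity
    set R := S.filter fun m => ¬ (0 < n * m ∧ NearScale (Nat.log 2 n.natAbs) m.natAbs)
    have e1 : ∑ m ∈ S, A n m * f m = ∑ m ∈ nearDiag S n, A n m * f m +
        (∑ m ∈ R.filter (fun m => m = -n), A n m * f m +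
          ∑ m ∈ R.filter (fun m => ¬ m = -n), A n m * f m) := by
      rw [Finset.sum_filter_add_sum_filter_not, nearDiag, Finset.sum_filter_add_sum_filter_not]
    have e2 : ‖∑ m ∈ R.filter (fun m => m = -n), A n m * f m‖ ≤ t / 3 := by
      refine le_trans ?_ h2'
      rw [← Finset.sum_filter]
      calc _ ≤ ∑ m ∈ R.filter (fun m => m = -n), C * ‖f m‖ :=
            (norm_sum_le _ _).trans (Finset.sum_le_sum fun m _ => by
              rw [norm_mul]; exact mul_le_mul_of_nonneg_right (hA.entry_le n m) (norm_nonneg _))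
        _ ≤ _ := Finset.sum_le_sum_of_subset_of_nonneg
            (Finset.filter_subset_filter _ (Finset.filter_subset _ _)) fun _ _ _ => by positivity
    have e3 : ‖∑ m ∈ R.filter (fun m => ¬ m = -n), A n m * f m‖ ≤ t / 3 := by
      refine (hbdd n (R.filter fun m => ¬ m = -n) (c := 2 * C / |(n : ℝ)|) (by positivity)
        ((Finset.filter_subset _ _).trans (Finset.filter_subset _ _)) fun m hm => ?_).trans ?_
      · obtain ⟨hm1, hm2⟩ := Finset.mem_filter.1 hm
        exact hA.entry_le_far hC hn0 hm2 (Finset.mem_filter.1 hm1).2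
      · rw [div_le_iff₀ ht] at h3'
        rw [div_mul_eq_mul_div, div_le_iff₀ hnpos]
        linarith
    have n1 := norm_add_le (∑ m ∈ nearDiag S n, A n m * f m)
      (∑ m ∈ R.filter (fun m => m = -n), A n m * f m +
          ∑ m ∈ R.filter (fun m => ¬ m = -n), A n m * f m)
    have n2 := norm_add_le (∑ m ∈ R.filter (fun m => m = -n), A n m * f m)
      (∑ m ∈ R.filter (fun m => ¬ m = -n), A n m * f m)
    rw [← e1] at n1
    linarith
  have hc : ((F.filter fun n => t < ‖∑ m ∈ S, A n m * f m‖).card : ℝ) ≤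
      E0.card + (E1.card + (E2.card + E3.card)) := by
    have h0 := Finset.card_le_card hsub
    have h1 := Finset.card_union_le E0 (E1 ∪ (E2 ∪ E3))
    have h2 := Finset.card_union_le E1 (E2 ∪ E3)
    have h3 := Finset.card_union_le E2 E3
    exact_mod_cast (by omega :
      (F.filter fun n => t < ‖∑ m ∈ S, A n m * f m‖).card ≤
        E0.card + (E1.card + (E2.card + E3.card)))
  have := mul_le_mul_of_nonneg_left hc ht.le
  linarith

/-! ### Marcinkiewicz interpolation and duality for finite matrices -/

open MeasureTheory in
theorem setIntegral_Ioi_ite_lt_rpow {a s : ℝ} (ha : 0 ≤ a) (hs : -1 < s) (c : ℝ) :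
    IntegrableOn (fun t : ℝ => if t < a then c * t ^ s else 0) (Set.Ioi 0) ∧
    ∫ t in Set.Ioi (0 : ℝ), (if t < a then c * t ^ s else 0) = c * (a ^ (s + 1) / (s + 1)) := by
  have e : (fun t : ℝ => if t < a then c * t ^ s else 0) =
      (Set.Iio a).indicator fun t => c * t ^ s := by
    ext t; simp [Set.indicator_apply]
  have hI : IntegrableOn (fun t : ℝ => c * t ^ s) (Set.Ioi 0 ∩ Set.Iio a) := by
    rw [Set.Ioi_inter_Iio]
    refine Integrable.const_mul ?_ c
    have := intervalIntegral.intervalIntegrable_rpow' (a := 0) (b := a) hs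
    exact ((intervalIntegrable_iff_integrableOn_Ioo_of_le ha).1 this)
  rw [e]
  constructor
  · rw [IntegrableOn, integrable_indicator_iff measurableSet_Iio, IntegrableOn,
      Measure.restrict_restrict measurableSet_Iio, Set.inter_comm]
    exact hI
  · rw [setIntegral_indicator measurableSet_Iio, integral_const_mul, Set.Ioi_inter_Iio,
      ← integral_Ioc_eq_integral_Ioo, ← intervalIntegral.integral_of_le ha,
      integral_rpow (Or.inl hs), Real.zero_rpow (by linarith), sub_zero]

open MeasureTheory in
theorem setIntegral_Ioi_ite_le_rpow {a s : ℝ} (ha : 0 < a) (hs : s < -1) (c : ℝ) :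
    IntegrableOn (fun t : ℝ => if a ≤ t then c * t ^ s else 0) (Set.Ioi 0) ∧
    ∫ t in Set.Ioi (0 : ℝ), (if a ≤ t then c * t ^ s else 0) =
      c * (-a ^ (s + 1) / (s + 1)) := by
  have e : (fun t : ℝ => if a ≤ t then c * t ^ s else 0) =
      (Set.Ici a).indicator fun t => c * t ^ s := by
    ext t; simp [Set.indicator_apply]
  have hi : Set.Ioi 0 ∩ Set.Ici a = Set.Ici a :=
    Set.inter_eq_right.2 fun t ht => ha.trans_le ht
  rw [e]
  constructor
  · rw [IntegrableOn, integrable_indicator_iff measurableSet_Ici, IntegrableOn,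
      Measure.restrict_restrict measurableSet_Ici, Set.inter_comm, hi, ← IntegrableOn,
      integrableOn_Ici_iff_integrableOn_Ioi]
    exact (integrableOn_Ioi_rpow_of_lt hs ha).const_mul c
  · rw [setIntegral_indicator measurableSet_Ici, hi, integral_const_mul,
      integral_Ici_eq_integral_Ioi, integral_Ioi_rpow_of_lt hs ha]

section FiniteMatrix

variable {ι κ : Type*}

/-- The distribution function of the image at height `t`, estimated by applying the weak bound to
the part of `f` above `t` and the `ℓ²` bound to the part below `t`. -/
theorem card_lt_norm_le_of_weak_strong (A : ι → κ → ℂ) (F : Finset ι) (S : Finset κ) {W B : ℝ}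
    (hw : ∀ (g : κ → ℂ) (t : ℝ), 0 < t →
      t * ((F.filter fun n => t < ‖∑ m ∈ S, A n m * g m‖).card : ℝ) ≤ W * ∑ m ∈ S, ‖g m‖)
    (h2 : ∀ g : κ → ℂ, ∑ n ∈ F, ‖∑ m ∈ S, A n m * g m‖ ^ 2 ≤ B * ∑ m ∈ S, ‖g m‖ ^ 2)
    (f : κ → ℂ) {t : ℝ} (ht : 0 < t) :
    t ^ 2 * ((F.filter fun n => t < ‖∑ m ∈ S, A n m * f m‖).card : ℝ) ≤
      ∑ m ∈ S, ((if t < ‖f m‖ then 2 * W * t * ‖f m‖ else 0) +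
        (if ‖f m‖ ≤ t then 4 * B * ‖f m‖ ^ 2 else 0)) := by
  classical
  set f₁ : κ → ℂ := fun m => if t < ‖f m‖ then f m else 0 with hf₁
  set f₂ : κ → ℂ := fun m => if ‖f m‖ ≤ t then f m else 0 with hf₂
  have hf : ∀ m, f m = f₁ m + f₂ m := by
    intro m
    simp only [hf₁, hf₂]
    rcases lt_or_ge t ‖f m‖ with h | h
    · rw [if_pos h, if_neg (not_le.2 h), add_zero]
    · rw [if_neg (not_lt.2 h), if_pos h, zero_add]
  have h1 := hw f₁ (t / 2) (by positivity)
  have h3 := card_mul_le_of_sum_le F (fun n => ‖∑ m ∈ S, A n m * f₂ m‖ ^ 2)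
    (fun _ _ => by positivity) (t := (t / 2) ^ 2) (h2 f₂)
  set E₁ := F.filter fun n => t / 2 < ‖∑ m ∈ S, A n m * f₁ m‖
  set E₂ := F.filter fun n => (t / 2) ^ 2 < ‖∑ m ∈ S, A n m * f₂ m‖ ^ 2
  have hsub : (F.filter fun n => t < ‖∑ m ∈ S, A n m * f m‖) ⊆ E₁ ∪ E₂ := by
    intro n hn
    obtain ⟨hnF, hn⟩ := Finset.mem_filter.1 hn
    by_cases h : t / 2 < ‖∑ m ∈ S, A n m * f₁ m‖
    · exact Finset.mem_union_left _ (Finset.mem_filter.2 ⟨hnF, h⟩)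
    · refine Finset.mem_union_right _ (Finset.mem_filter.2 ⟨hnF, ?_⟩)
      have e : ∑ m ∈ S, A n m * f m = ∑ m ∈ S, A n m * f₁ m + ∑ m ∈ S, A n m * f₂ m := by
        rw [← Finset.sum_add_distrib]
        exact Finset.sum_congr rfl fun m _ => by rw [hf m]; ring
      have := norm_add_le (∑ m ∈ S, A n m * f₁ m) (∑ m ∈ S, A n m * f₂ m)
      rw [← e] at this
      exact pow_lt_pow_left₀ (by linarith) (by positivity) two_ne_zero
  have hc : ((F.filter fun n => t < ‖∑ m ∈ S, A n m * f m‖).card : ℝ) ≤ E₁.card + E₂.card := by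
    exact_mod_cast (Finset.card_le_card hsub).trans (Finset.card_union_le _ _)
  have e1 : ∑ m ∈ S, (if t < ‖f m‖ then 2 * W * t * ‖f m‖ else 0) =
      2 * t * (W * ∑ m ∈ S, ‖f₁ m‖) := by
    rw [Finset.mul_sum, Finset.mul_sum]
    refine Finset.sum_congr rfl fun m _ => ?_
    simp only [hf₁]
    split_ifs
    · ring
    · simp
  have e2 : ∑ m ∈ S, (if ‖f m‖ ≤ t then 4 * B * ‖f m‖ ^ 2 else 0) =
      4 * (B * ∑ m ∈ S, ‖f₂ m‖ ^ 2) := by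
    rw [Finset.mul_sum, Finset.mul_sum]
    refine Finset.sum_congr rfl fun m _ => ?_
    simp only [hf₂]
    split_ifs
    · ring
    · simp
  rw [Finset.sum_add_distrib, e1, e2]
  calc _ ≤ t ^ 2 * ((E₁.card : ℝ) + E₂.card) := mul_le_mul_of_nonneg_left hc (by positivity)
    _ = 2 * t * (t / 2 * (E₁.card : ℝ)) + 4 * ((t / 2) ^ 2 * (E₂.card : ℝ)) := by ring
    _ ≤ _ := by gcongr

open MeasureTheory in
/-- Marcinkiewicz interpolation between weak type (1,1) and strong type (2,2), with a constant
independent of the size of the matrix: multiply the estimate of the distribution function by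
`p * t ^ (p - 3)` and integrate over `t > 0`. -/
theorem sum_rpow_le_of_weak_strong (A : ι → κ → ℂ) (F : Finset ι) (S : Finset κ) {W B : ℝ}
    (hw : ∀ (g : κ → ℂ) (t : ℝ), 0 < t →
      t * ((F.filter fun n => t < ‖∑ m ∈ S, A n m * g m‖).card : ℝ) ≤ W * ∑ m ∈ S, ‖g m‖)
    (h2 : ∀ g : κ → ℂ, ∑ n ∈ F, ‖∑ m ∈ S, A n m * g m‖ ^ 2 ≤ B * ∑ m ∈ S, ‖g m‖ ^ 2)
    {p : ℝ} (hp1 : 1 < p) (hp2 : p < 2) (f : κ → ℂ) :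
    ∑ n ∈ F, ‖∑ m ∈ S, A n m * f m‖ ^ p ≤
      p * (2 * W / (p - 1) + 4 * B / (2 - p)) * ∑ m ∈ S, ‖f m‖ ^ p := by
  set u : ι → ℝ := fun n => ‖∑ m ∈ S, A n m * f m‖ with hu
  have hL : ∀ n ∈ F, IntegrableOn (fun t : ℝ => if t < u n then p * t ^ (p - 1) else 0)
      (Set.Ioi 0) ∧ ∫ t in Set.Ioi (0 : ℝ), (if t < u n then p * t ^ (p - 1) else 0) =
        u n ^ p := by
    intro n _
    have := setIntegral_Ioi_ite_lt_rpow (a := u n) (s := p - 1) (norm_nonneg _) (by linarith) p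
    rwa [sub_add_cancel, mul_div_cancel₀ _ (by linarith)] at this
  have hR1 : ∀ m ∈ S, IntegrableOn
      (fun t : ℝ => if t < ‖f m‖ then p * (2 * W) * ‖f m‖ * t ^ (p - 2) else 0) (Set.Ioi 0) ∧
      ∫ t in Set.Ioi (0 : ℝ), (if t < ‖f m‖ then p * (2 * W) * ‖f m‖ * t ^ (p - 2) else 0) =
        p * (2 * W / (p - 1)) * ‖f m‖ ^ p := by
    intro m _
    have := setIntegral_Ioi_ite_lt_rpow (a := ‖f m‖) (s := p - 2) (norm_nonneg _) (by linarith)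
      (p * (2 * W) * ‖f m‖)
    refine ⟨this.1, this.2.trans ?_⟩
    have e : ‖f m‖ * ‖f m‖ ^ (p - 1) = ‖f m‖ ^ p := by
      rw [← Real.rpow_one_add' (norm_nonneg _) (by linarith)]; congr 1; ring
    rw [← e, show p - 2 + 1 = p - 1 by ring]
    ring
  have hR2 : ∀ m ∈ S, IntegrableOn
      (fun t : ℝ => if ‖f m‖ ≤ t then p * (4 * B) * ‖f m‖ ^ 2 * t ^ (p - 3) else 0) (Set.Ioi 0) ∧
      ∫ t in Set.Ioi (0 : ℝ), (if ‖f m‖ ≤ t then p * (4 * B) * ‖f m‖ ^ 2 * t ^ (p - 3) else 0) =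
        p * (4 * B / (2 - p)) * ‖f m‖ ^ p := by
    intro m _
    -- For `f m = 0` the integral of `t ^ (p - 3)` diverges at `0`, but its coefficient vanishes.
    rcases (norm_nonneg (f m)).eq_or_lt with h | h
    · rw [← h]
      simp [Real.zero_rpow (by linarith : p ≠ 0)]
    have := setIntegral_Ioi_ite_le_rpow (a := ‖f m‖) (s := p - 3) h (by linarith)
      (p * (4 * B) * ‖f m‖ ^ 2)
    refine ⟨this.1, this.2.trans ?_⟩
    have e : ‖f m‖ ^ 2 * ‖f m‖ ^ (p - 2) = ‖f m‖ ^ p := by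
      rw [← Real.rpow_natCast, ← Real.rpow_add h]; congr 1; push_cast; ring
    rw [← e, show p - 3 + 1 = p - 2 by ring, neg_div, ← div_neg, neg_sub]
    ring
  have hRint : ∀ m ∈ S, IntegrableOn (fun t : ℝ =>
      (if t < ‖f m‖ then p * (2 * W) * ‖f m‖ * t ^ (p - 2) else 0) +
      (if ‖f m‖ ≤ t then p * (4 * B) * ‖f m‖ ^ 2 * t ^ (p - 3) else 0)) (Set.Ioi 0) :=
    fun m hm => (hR1 m hm).1.add (hR2 m hm).1
  calc ∑ n ∈ F, u n ^ p
      = ∫ t in Set.Ioi (0 : ℝ), ∑ n ∈ F, (if t < u n then p * t ^ (p - 1) else 0) := by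
        rw [integral_finsetSum _ fun n hn => (hL n hn).1]
        exact Finset.sum_congr rfl fun n hn => (hL n hn).2.symm
    _ ≤ ∫ t in Set.Ioi (0 : ℝ), ∑ m ∈ S,
          ((if t < ‖f m‖ then p * (2 * W) * ‖f m‖ * t ^ (p - 2) else 0) +
          (if ‖f m‖ ≤ t then p * (4 * B) * ‖f m‖ ^ 2 * t ^ (p - 3) else 0)) := by
        refine setIntegral_mono_on (integrable_finsetSum _ fun n hn => (hL n hn).1)
          (integrable_finsetSum _ hRint) measurableSet_Ioi fun t ht => ?_
        have ht : 0 < t := ht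
        have hd := card_lt_norm_le_of_weak_strong A F S hw h2 f ht
        have e0 : t ^ (p - 1) = t ^ (p - 3) * t ^ 2 := by
          rw [← Real.rpow_natCast, ← Real.rpow_add ht]; congr 1; push_cast; ring
        have e1 : t ^ (p - 2) = t ^ (p - 3) * t := by
          rw [← Real.rpow_add_one ht.ne']; congr 1; ring
        calc ∑ n ∈ F, (if t < u n then p * t ^ (p - 1) else 0)
            = p * t ^ (p - 3) * (t ^ 2 * ((F.filter fun n => t < u n).card : ℝ)) := by
              rw [← Finset.sum_filter, Finset.sum_const, nsmul_eq_mul, e0]; ring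
          _ ≤ p * t ^ (p - 3) * _ := mul_le_mul_of_nonneg_left hd (by positivity)
          _ = _ := by
              rw [Finset.mul_sum]
              refine Finset.sum_congr rfl fun m _ => ?_
              rw [mul_add, mul_ite, mul_ite, mul_zero, e1]
              congr 2 <;> ring
    _ = ∑ m ∈ S, (p * (2 * W / (p - 1)) * ‖f m‖ ^ p + p * (4 * B / (2 - p)) * ‖f m‖ ^ p) := by
        rw [integral_finsetSum _ hRint]
        refine Finset.sum_congr rfl fun m hm => ?_
        rw [integral_add (hR1 m hm).1 (hR2 m hm).1, (hR1 m hm).2, (hR2 m hm).2]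
    _ = _ := by
        rw [Finset.mul_sum]
        exact Finset.sum_congr rfl fun m _ => by ring

/-- Duality: an `ℓ^q` bound for the transposed matrix gives an `ℓ^p` bound for the matrix, by
pairing the image `u` of `f` with the extremal sequence `conj u * |u| ^ (p - 2)`. -/
theorem sum_rpow_le_of_transpose (A : ι → κ → ℂ) (F : Finset ι) (S : Finset κ) {p q D : ℝ}
    (hpq : p.HolderConjugate q) (hD : 0 ≤ D)
    (h : ∀ g : ι → ℂ, ∑ m ∈ S, ‖∑ n ∈ F, A n m * g n‖ ^ q ≤ D * ∑ n ∈ F, ‖g n‖ ^ q)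
    (f : κ → ℂ) :
    ∑ n ∈ F, ‖∑ m ∈ S, A n m * f m‖ ^ p ≤ D ^ (p - 1) * ∑ m ∈ S, ‖f m‖ ^ p := by
  set u : ι → ℂ := fun n => ∑ m ∈ S, A n m * f m with hu
  set X := ∑ n ∈ F, ‖u n‖ ^ p with hX
  set Y := ∑ m ∈ S, ‖f m‖ ^ p with hY
  have hX0 : 0 ≤ X := Finset.sum_nonneg fun _ _ => by positivity
  have hY0 : 0 ≤ Y := Finset.sum_nonneg fun _ _ => by positivity
  rcases hX0.eq_or_lt with hz | hXpos
  · rw [← hz]; positivity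
  have hp0 : 0 < p := hpq.pos
  have hq0 : 0 < q := hpq.symm.pos
  set g : ι → ℂ := fun n => starRingEnd ℂ (u n) * ((‖u n‖ ^ (p - 2) : ℝ) : ℂ) with hg
  have hgu : ∀ n, g n * u n = ((‖u n‖ ^ p : ℝ) : ℂ) := by
    intro n
    rcases eq_or_ne (u n) 0 with h0 | h0
    · simp [h0, Real.zero_rpow hp0.ne']
    have hn : 0 < ‖u n‖ := norm_pos_iff.2 h0
    have e : ‖u n‖ ^ p = ‖u n‖ ^ 2 * ‖u n‖ ^ (p - 2) := by
      rw [← Real.rpow_natCast, ← Real.rpow_add hn]; congr 1; push_cast; ring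
    rw [e, hg]
    simp only
    rw [mul_right_comm, ← Complex.normSq_eq_conj_mul_self, Complex.normSq_eq_norm_sq]
    push_cast
    ring
  have hgn : ∀ n, ‖g n‖ ^ q = ‖u n‖ ^ p := by
    intro n
    rcases eq_or_ne (u n) 0 with h0 | h0
    · simp [hg, h0, Real.zero_rpow hp0.ne', Real.zero_rpow hq0.ne']
    have hn : 0 < ‖u n‖ := norm_pos_iff.2 h0
    have e : ‖g n‖ = ‖u n‖ ^ (p - 1) := by
      rw [hg]
      simp only [norm_mul, RCLike.norm_conj, Complex.norm_real, Real.norm_eq_abs]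
      rw [abs_of_nonneg (by positivity), ← Real.rpow_one_add' hn.le (by linarith [hpq.lt])]
      congr 1; ring
    rw [e, ← Real.rpow_mul hn.le, hpq.sub_one_mul_conj]
  have hkey : X ≤ Y ^ (1 / p) * (D * X) ^ (1 / q) := by
    have e : ((X : ℝ) : ℂ) = ∑ m ∈ S, f m * ∑ n ∈ F, A n m * g n := by
      rw [hX]; push_cast
      calc ∑ n ∈ F, ((‖u n‖ ^ p : ℝ) : ℂ) = ∑ n ∈ F, ∑ m ∈ S, g n * (A n m * f m) :=
            Finset.sum_congr rfl fun n _ => by rw [← hgu n, hu, Finset.mul_sum]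
        _ = ∑ m ∈ S, f m * ∑ n ∈ F, A n m * g n := by
            rw [Finset.sum_comm]
            refine Finset.sum_congr rfl fun m _ => ?_
            rw [Finset.mul_sum]
            exact Finset.sum_congr rfl fun n _ => by ring
    calc X = ‖((X : ℝ) : ℂ)‖ := by rw [Complex.norm_real, Real.norm_of_nonneg hX0]
      _ ≤ ∑ m ∈ S, ‖f m‖ * ‖∑ n ∈ F, A n m * g n‖ := by
          rw [e]
          exact (norm_sum_le _ _).trans (Finset.sum_le_sum fun m _ => (norm_mul _ _).le)
      _ ≤ Y ^ (1 / p) * (∑ m ∈ S, ‖∑ n ∈ F, A n m * g n‖ ^ q) ^ (1 / q) :=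
          Real.inner_le_Lp_mul_Lq_of_nonneg S hpq (fun _ _ => norm_nonneg _)
            fun _ _ => norm_nonneg _
      _ ≤ Y ^ (1 / p) * (D * X) ^ (1 / q) := by
          have := h g
          rw [Finset.sum_congr rfl fun n _ => hgn n] at this
          gcongr
  have hpw := Real.rpow_le_rpow hX0 hkey hp0.le
  have e1 : (1 / q) * p = p - 1 := by
    have := hpq.sub_one_mul_conj
    field_simp
    linarith
  rw [Real.mul_rpow (by positivity) (by positivity), ← Real.rpow_mul hY0,
    one_div_mul_cancel hp0.ne', Real.rpow_one, ← Real.rpow_mul (by positivity), e1,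
    Real.mul_rpow hD hX0, ← sub_add_cancel p 1, Real.rpow_add_one hXpos.ne', sub_add_cancel] at hpw
  refine le_of_mul_le_mul_left ?_ (Real.rpow_pos_of_pos hXpos (p - 1))
  linarith

end FiniteMatrix

/-! ### Extension of the operator -/

/-- A uniform bound on the finite sections makes each row summable against sequences in `ℓ^r`: by
the bound for that single row, tails of `f` have small image. -/
theorem summable_row_of_sum_rpow_le {A : ℤ → ℤ → ℂ} {r D : ℝ} (hr : 0 < r) (hD : 0 ≤ D)
    (h : ∀ (F S : Finset ℤ) (f : ℤ → ℂ), ∑ n ∈ F, ‖∑ m ∈ S, A n m * f m‖ ^ r ≤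
      D * ∑ m ∈ S, ‖f m‖ ^ r)
    {f : ℤ → ℂ} (hf : Summable fun m => ‖f m‖ ^ r) (n : ℤ) : Summable fun m => A n m * f m := by
  rw [summable_iff_vanishing_norm] at hf ⊢
  intro ε hε
  obtain ⟨s, hs⟩ := hf (ε ^ r / (D + 1)) (by positivity)
  refine ⟨s, fun t ht => ?_⟩
  have h1 := hs t ht
  rw [Real.norm_of_nonneg (Finset.sum_nonneg fun _ _ => by positivity),
    lt_div_iff₀ (by positivity)] at h1
  have h2 := h {n} t f
  rw [Finset.sum_singleton] at h2
  have h0 : 0 ≤ ∑ m ∈ t, ‖f m‖ ^ r := Finset.sum_nonneg fun _ _ => by positivity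
  have h3 : ‖∑ m ∈ t, A n m * f m‖ ^ r < ε ^ r := by nlinarith
  exact (Real.rpow_lt_rpow_iff (norm_nonneg _) hε.le hr).1 h3

theorem extendsBoundedly_of_sum_rpow_le {T : EllZ 2 →L[ℂ] EllZ 2} {A : ℤ → ℤ → ℂ}
    (hA : ∀ (f : EllZ 2) (n : ℤ), HasSum (fun m => A n m * f m) (T f n))
    {p : ℝ≥0∞} [Fact (1 ≤ p)] (hp : p < ∞) {D : ℝ} (hD : 0 ≤ D)
    (h : ∀ (F S : Finset ℤ) (f : ℤ → ℂ), ∑ n ∈ F, ‖∑ m ∈ S, A n m * f m‖ ^ p.toReal ≤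
      D * ∑ m ∈ S, ‖f m‖ ^ p.toReal) : ExtendsBoundedly T p := by
  have hr : 0 < p.toReal :=
    ENNReal.toReal_pos (zero_lt_one.trans_le (Fact.out : 1 ≤ p)).ne' hp.ne
  have hfs : ∀ f : EllZ p, Summable fun m => ‖f m‖ ^ p.toReal := fun f =>
    (lp.hasSum_norm hr f).summable
  have hsum : ∀ (f : EllZ p) (n : ℤ), Summable fun m => A n m * f m := fun f n =>
    summable_row_of_sum_rpow_le hr hD h (hfs f) n
  have hbound : ∀ (f : EllZ p) (F : Finset ℤ),
      ∑ n ∈ F, ‖∑' m, A n m * f m‖ ^ p.toReal ≤ D * ‖f‖ ^ p.toReal := by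
    intro f F
    have hlim : Filter.Tendsto (fun S : Finset ℤ => ∑ n ∈ F, ‖∑ m ∈ S, A n m * f m‖ ^ p.toReal)
        Filter.atTop (nhds (∑ n ∈ F, ‖∑' m, A n m * f m‖ ^ p.toReal)) :=
      tendsto_finsetSum _ fun n _ =>
        ((hsum f n).hasSum.norm).rpow_const (Or.inr hr.le)
    refine le_of_tendsto' hlim fun S => (h F S f).trans ?_
    exact mul_le_mul_of_nonneg_left (lp.sum_rpow_le_norm_rpow hr f S) hD
  let L : EllZ p →ₗ[ℂ] EllZ p :=
    { toFun := fun f => ⟨fun n => ∑' m, A n m * f m, memℓp_gen' (hbound f)⟩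
      map_add' := by
        intro f g
        ext n
        change ∑' m, A n m * (f m + g m) = ∑' m, A n m * f m + ∑' m, A n m * g m
        rw [← (hsum f n).tsum_add (hsum g n)]
        exact tsum_congr fun m => mul_add _ _ _
      map_smul' := by
        intro c f
        ext n
        change ∑' m, A n m * (c * f m) = c * ∑' m, A n m * f m
        rw [← tsum_mul_left]
        exact tsum_congr fun m => mul_left_comm _ _ _ }
  refine ⟨L.mkContinuous (D ^ p.toReal⁻¹) fun f => ?_, ?_⟩
  · refine lp.norm_le_of_forall_sum_le hr (by positivity) fun F => ?_
    rw [Real.mul_rpow (by positivity) (norm_nonneg _), Real.rpow_inv_rpow hD hr.ne']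
    exact hbound f F
  · intro f h2 hp n
    exact (hA ⟨f, h2⟩ n).tsum_eq

/-- The entry `(T eₘ) n` of the matrix of `T` in the standard basis. -/
noncomputable def matrixEntry (T : EllZ 2 →L[ℂ] EllZ 2) (n m : ℤ) : ℂ := T (lp.single 2 m 1) n

theorem apply_sum_single (T : EllZ 2 →L[ℂ] EllZ 2) (S : Finset ℤ) (f : ℤ → ℂ) (n : ℤ) :
    T (∑ m ∈ S, lp.single 2 m (f m)) n = ∑ m ∈ S, matrixEntry T n m * f m := by
  have hsm : ∀ m, (lp.single 2 m (f m) : EllZ 2) = f m • lp.single 2 m (1 : ℂ) := by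
    intro m
    rw [← lp.single_smul, smul_eq_mul, mul_one]
  rw [map_sum, lp.coeFn_sum, Finset.sum_apply]
  refine Finset.sum_congr rfl fun m _ => ?_
  rw [hsm, map_smul, lp.coeFn_smul, Pi.smul_apply, smul_eq_mul, mul_comm]
  rfl

theorem hasSum_matrixEntry (T : EllZ 2 →L[ℂ] EllZ 2) (f : EllZ 2) (n : ℤ) :
    HasSum (fun m => matrixEntry T n m * f m) (T f n) := by
  have h := (lp.hasSum_single (p := 2) (by norm_num) f).mapL
    ((lp.evalCLM ℂ (fun _ : ℤ => ℂ) 2 n).comp T)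
  refine (funext fun m => ?_ : (fun m => matrixEntry T n m * f m) = _) ▸ h
  have := apply_sum_single T {m} f n
  rw [Finset.sum_singleton, Finset.sum_singleton] at this
  exact this.symm

theorem matrixEntry_l2_bound (T : EllZ 2 →L[ℂ] EllZ 2) (F S : Finset ℤ) (f : ℤ → ℂ) :
    ∑ n ∈ F, ‖∑ m ∈ S, matrixEntry T n m * f m‖ ^ 2 ≤ ‖T‖ ^ 2 * ∑ m ∈ S, ‖f m‖ ^ 2 := by
  have h2 : (0 : ℝ) < (2 : ℝ≥0∞).toReal := by norm_num
  have h1 := lp.sum_rpow_le_norm_rpow h2 (T (∑ m ∈ S, lp.single 2 m (f m))) F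
  have h3 := lp.norm_sum_single (p := 2) h2 f S
  have e2 : (2 : ℝ≥0∞).toReal = ((2 : ℕ) : ℝ) := by norm_num
  simp only [e2, Real.rpow_natCast, apply_sum_single] at h1 h3
  refine h1.trans ?_
  rw [← h3, ← mul_pow]
  exact pow_le_pow_left₀ (norm_nonneg _) (T.le_opNorm _) 2

/-- The unit vector `eₘ` vanishes at `±n` when `|n| ≠ |m|`, so the kernel formula applies to it. -/
theorem matrixEntry_eq_kernel {T : EllZ 2 →L[ℂ] EllZ 2} {K : ℤ → ℤ → ℂ}
    (hT : HasOffDiagKernel T K) {n m : ℤ} (h : |n| ≠ |m|) : matrixEntry T n m = K n m := by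
  have h1 : n ≠ m := fun e => h (by rw [e])
  have h2 : -n ≠ m := fun e => h (by rw [← e, abs_neg])
  rw [matrixEntry, hT _ n (lp.single_apply_ne _ _ _ h1) (lp.single_apply_ne _ _ _ h2),
    tsum_eq_single m]
  · rw [lp.single_apply_self, mul_one]
  · intro l hl
    rw [lp.single_apply_ne _ _ _ hl, mul_zero]

theorem abs_ne_abs_of_far {n m l : ℤ}
    (h : 2 * |(m : ℝ) - l| < |(|(m : ℝ)| - |(n : ℝ)|)|) : |n| ≠ |m| ∧ |n| ≠ |l| := by
  have h0 := abs_nonneg ((m : ℝ) - l)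
  constructor
  · intro e
    have e' : |(n : ℝ)| = |(m : ℝ)| := by exact_mod_cast e
    rw [e', sub_self, abs_zero] at h
    linarith
  · intro e
    have e' : |(n : ℝ)| = |(l : ℝ)| := by exact_mod_cast e
    have := abs_abs_sub_abs_le_abs_sub (m : ℝ) l
    rw [e'] at h
    linarith

/-- Regularity of `K` passes to `A`, since the far condition keeps both columns off the diagonals
`|n| = |m|`, where `A` and `K` may differ. -/
theorem isCZMatrix_of_kernel {A K : ℤ → ℤ → ℂ} {B M C : ℝ}
    (hK : ∀ n m : ℤ, |n| ≠ |m| → A n m = K n m)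
    (hL2 : ∀ (F S : Finset ℤ) (g : ℤ → ℂ), ∑ n ∈ F, ‖∑ m ∈ S, A n m * g m‖ ^ 2 ≤
      B * ∑ m ∈ S, ‖g m‖ ^ 2)
    (hentry : ∀ n m, ‖A n m‖ ≤ M) (hM : 0 ≤ M) (hC : 0 ≤ C)
    (hsize : ∀ n m : ℤ, |n| ≠ |m| → ‖K n m‖ ≤ C / |(n : ℝ) - m|)
    (hdiff : ∀ n m l : ℤ,
      2 * |(m : ℝ) - l| < |(|(m : ℝ)| - |(n : ℝ)|)| →
      |(n : ℝ)| / 2 ≤ |(m : ℝ)| → |(m : ℝ)| ≤ 3 * |(n : ℝ)| / 2 →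
      |(n : ℝ)| / 2 ≤ |(l : ℝ)| → |(l : ℝ)| ≤ 3 * |(n : ℝ)| / 2 →
      ‖K n m - K n l‖ ≤ C * (|(m : ℝ) - l| / (|(m : ℝ)| - |(n : ℝ)|) ^ 2)) :
    IsCZMatrix A B (M + C) where
  l2_bound := hL2
  entry_le n m := (hentry n m).trans (by linarith)
  size_le n m h := by
    rw [hK n m h]
    refine (hsize n m h).trans ?_
    gcongr
    linarith
  diff_le n m l h h1 h2 h3 h4 := by
    obtain ⟨hm, hl⟩ := abs_ne_abs_of_far h
    rw [hK n m hm, hK n l hl]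
    refine (hdiff n m l h h1 h2 h3 h4).trans ?_
    gcongr
    linarith

theorem IsCZMatrix.exists_sum_rpow_le {A : ℤ → ℤ → ℂ} {B C : ℝ} (hA : IsCZMatrix A B C)
    (hB : 0 ≤ B) (hC : 0 ≤ C) {p : ℝ} (hp1 : 1 < p) (hp2 : p < 2) :
    ∃ D : ℝ, 0 ≤ D ∧ ∀ (F S : Finset ℤ) (f : ℤ → ℂ),
      ∑ n ∈ F, ‖∑ m ∈ S, A n m * f m‖ ^ p ≤ D * ∑ m ∈ S, ‖f m‖ ^ p := by
  have h1 : 0 < p - 1 := by linarith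
  have h2 : 0 < 2 - p := by linarith
  refine ⟨p * (2 * (18 * (7 + 32 * C + 8 * B) + 16 * C) / (p - 1) + 4 * B / (2 - p)),
    by positivity, fun F S f => ?_⟩
  exact sum_rpow_le_of_weak_strong A F S (fun g t ht => hA.weak_type hB hC F S g ht)
    (fun g => hA.l2_bound F S g) hp1 hp2 f

theorem theorem3p3 (T : EllZ 2 →L[ℂ] EllZ 2) (K : ℤ → ℤ → ℂ) (C : ℝ)
    (hT : HasOffDiagKernel T K)
    (hsize : ∀ n m : ℤ, |n| ≠ |m| → ‖K n m‖ ≤ C / |(n : ℝ) - m|)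
    (hdiff : ∀ n m l : ℤ,
      2 * |(m : ℝ) - l| < |(|(m : ℝ)| - |(n : ℝ)|)| →
      |(n : ℝ)| / 2 ≤ |(m : ℝ)| → |(m : ℝ)| ≤ 3 * |(n : ℝ)| / 2 →
      |(n : ℝ)| / 2 ≤ |(l : ℝ)| → |(l : ℝ)| ≤ 3 * |(n : ℝ)| / 2 →
      ‖K n m - K n l‖ + ‖K m n - K l n‖ ≤ C * (|(m : ℝ) - l| / (|(m : ℝ)| - |(n : ℝ)|) ^ 2)) :
    ∀ (p : ℝ≥0∞) [Fact (1 ≤ p)], 1 < p → p < ∞ → ExtendsBoundedly T p := by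
  intro p _ hp1 hp
  set A := matrixEntry T with hAdef
  have hC : 0 ≤ C := by
    have := (norm_nonneg _).trans (hsize 0 1 (by norm_num))
    simpa using this
  have hB : 0 ≤ ‖T‖ ^ 2 := by positivity
  have hMC : 0 ≤ ‖T‖ + C := by positivity
  have hL2 : ∀ (F S : Finset ℤ) (g : ℤ → ℂ), ∑ n ∈ F, ‖∑ m ∈ S, A n m * g m‖ ^ 2 ≤
      ‖T‖ ^ 2 * ∑ m ∈ S, ‖g m‖ ^ 2 := matrixEntry_l2_bound T
  have hentry : ∀ n m, ‖A n m‖ ≤ ‖T‖ := by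
    intro n m
    have := hL2 {n} {m} (fun _ => 1)
    simp only [Finset.sum_singleton, mul_one, norm_one, one_pow] at this
    exact le_of_sq_le_sq this (norm_nonneg _)
  -- The transposed matrix inherits the `ℓ²` bound by duality.
  have hL2t : ∀ (F S : Finset ℤ) (g : ℤ → ℂ), ∑ n ∈ F, ‖∑ m ∈ S, A m n * g m‖ ^ 2 ≤
      ‖T‖ ^ 2 * ∑ m ∈ S, ‖g m‖ ^ 2 := by
    intro F S g
    have := sum_rpow_le_of_transpose (fun n m => A m n) F S (p := 2) (q := 2) (D := ‖T‖ ^ 2)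
      Real.HolderConjugate.two_two hB (fun g => by exact_mod_cast hL2 S F g) g
    norm_num at this
    exact_mod_cast this
  have hcz : IsCZMatrix A (‖T‖ ^ 2) (‖T‖ + C) :=
    isCZMatrix_of_kernel (fun n m h => matrixEntry_eq_kernel hT h) hL2 hentry (norm_nonneg _) hC
      hsize fun n m l h h1 h2 h3 h4 =>
        (le_add_of_nonneg_right (norm_nonneg _)).trans (hdiff n m l h h1 h2 h3 h4)
  have hczt : IsCZMatrix (fun n m => A m n) (‖T‖ ^ 2) (‖T‖ + C) :=
    isCZMatrix_of_kernel (K := fun n m => K m n)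
      (fun n m h => matrixEntry_eq_kernel hT h.symm) hL2t
      (fun n m => hentry m n) (norm_nonneg _) hC
      (fun n m h => by rw [abs_sub_comm]; exact hsize m n h.symm) fun n m l h h1 h2 h3 h4 =>
        (le_add_of_nonneg_left (norm_nonneg _)).trans (hdiff n m l h h1 h2 h3 h4)
  have hr1 : 1 < p.toReal := by
    rw [← ENNReal.toReal_one]
    exact (ENNReal.toReal_lt_toReal ENNReal.one_ne_top hp.ne).2 hp1
  suffices h : ∃ D : ℝ, 0 ≤ D ∧ ∀ (F S : Finset ℤ) (f : ℤ → ℂ),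
      ∑ n ∈ F, ‖∑ m ∈ S, A n m * f m‖ ^ p.toReal ≤ D * ∑ m ∈ S, ‖f m‖ ^ p.toReal by
    obtain ⟨D, hD, h⟩ := h
    exact extendsBoundedly_of_sum_rpow_le (hasSum_matrixEntry T) hp hD h
  rcases lt_trichotomy p.toReal 2 with h | h | h
  · exact hcz.exists_sum_rpow_le hB hMC hr1 h
  · exact ⟨‖T‖ ^ 2, hB, fun F S f => by rw [h]; exact_mod_cast hL2 F S f⟩
  · have hpq := Real.HolderConjugate.conjExponent hr1
    have hq2 : p.toReal.conjExponent < 2 := by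
      rw [Real.conjExponent, div_lt_iff₀ (by linarith)]
      linarith
    obtain ⟨D, hD, h⟩ := hczt.exists_sum_rpow_le hB hMC hpq.symm.lt hq2
    exact ⟨D ^ (p.toReal - 1), by positivity, fun F S f =>
      sum_rpow_le_of_transpose A F S hpq hD (fun g => h S F g) f⟩
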